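/- **Setting.** Let $S\subset\mathbb R^n$ be an unbounded, locally compact set with $0\in S$, let $E=S\cup\{\infty\}$ be its Alexandroff one-point compactification with its Borel $\sigma$-field, let $\mathring E=\mathring S\setminus\{0\}$ ($\mathring S$ the interior of $S$ in $\mathbb R^n$) and $\partial E=E\setminus\mathring E$. Let $X=((X_t)_{t\ge0},(\mathbb P_x)_{x\in E})$ be a standard Markov process on $E$: it is adapted to a right-continuous complete filtration, $\mathbb P_x(X_0=x)=1$, its transition function is Borel in the starting point, its paths are right-continuous on $[0,\infty)$ with left limits, it is strong Markov, and it is quasi-left-continuous on $[0,\zeta)$, where $\zeta=\inf\{s>0:X_s\notin\mathring E\}$. Assume that $X$ is absorbed at $\partial E$, and irreducible: from every $x\in\mathring E$ it reaches every nonempty open subset of $E$ with positive probability. For $D\subset E$ let $\tau_D=\inf\{s>0:X_s\notin D\}$. A Borel function $f:E\to[0,\infty]$ is *excessive on* $D$ if for all $x\in D$ one has $\mathbb E_x[f(X_t);t<\tau_D]\le f(x)$ for all $t\ge0$ and $\lim_{t\to0+}\mathbb E_x[f(X_t);t<\tau_D]=f(x)$; it is *excessive* if it is excessive on $E$. For $h$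 excessive put $E_h=\{0<h<\infty\}$. The Doob transform $X^h$ (killed when it exits $\mathring E$) is the sub-Markov process with semigroup $P^h_tf(x)=\mathbb E_x\big[\tfrac{h(X_t)}{h(x)}f(X_t);t<\tau_{E_h\cap\mathring E}\big]$ for $x\in E_h$, and $P^h_tf(x)=0$ for $x\notin E_h$. $X$ has the *inversion property* with characteristics $(I,h,v)$ if $I\ne\mathrm{Id}$ is a Borel involution of $E$, $h\ge0$ is excessive with $0<h<\infty$ on $\mathring E$, $v$ is a positive continuous function on $\mathring E$, and, for every $x\in E$, with $\gamma_t=\inf\{s:A_s>t\}$ the inverse of $A_t=\int_0^tv(X_s)^{-1}\,ds$, the process $I(X_{\gamma_t})$ under $\mathbb P_x$, considered while $\gamma_t<\zeta$, has the same finite-dimensional distributions as $X^h$ started from $I(x)$. The characteristics are *continuous* if $I$ and $h$ are continuous on $\mathring E$. **Theorem.** Suppose that $X$ has the inversion property with continuous characteristics $(I,h,v)$. Let $D\subset E_h$ be open in $E$, and let $H:E\to[0,\infty]$ be a function with $H=0$ on $\partial E$ that is continuous on $D\cap\mathring E$ and excessive on $D$. Then the function $x\mapsto h(x)\,H(I(x))$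 is excessive on $I(D)$. -/

import Mathlib

open MeasureTheory Set Filter Topology
open scoped NNReal ENNReal

noncomputable section

namespace Inversion

/-- The state space `E`: the one-point compactification of a subset `S` of `ℝⁿ`
(with the subspace topology). -/
abbrev State {n : ℕ} (S : Set (EuclideanSpace ℝ (Fin n))) : Type := OnePoint S

instance {n : ℕ} (S : Set (EuclideanSpace ℝ (Fin n))) : MeasurableSpace (State S) :=
  borel (State S)

instance {n : ℕ} (S : Set (EuclideanSpace ℝ (Fin n))) : BorelSpace (State S) := ⟨rfl⟩

/-- The interior `E° = S° \ {0}` of the state space: what is left of `E` after removal of the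
boundary `∂E = ∂S ∪ {0, ∞}` (here `S°` is the interior of `S` in `ℝⁿ`). -/
def inner {n : ℕ} (S : Set (EuclideanSpace ℝ (Fin n))) : Set (State S) :=
  (fun y : S => (y : OnePoint S)) '' {y | (y : EuclideanSpace ℝ (Fin n)) ∈ interior S \ {0}}

/-- First exit time `inf {s > 0 : X_s ∉ D}` of a process from `D` (it is `∞` if there is no
such `s`). -/
def exitTime {α Ω : Type*} (X : ℝ≥0 → Ω → α) (D : Set α) (ω : Ω) : ℝ≥0∞ :=
  ⨅ (s : ℝ≥0) (_ : 0 < s ∧ X s ω ∉ D), (s : ℝ≥0∞)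

/-- An irreducible standard Markov process on `E`, absorbed at `∂E`. -/
structure StandardProcess {n : ℕ} (S : Set (EuclideanSpace ℝ (Fin n)))
    (Ω : Type*) [mΩ : MeasurableSpace Ω] where
  /-- the filtration -/
  ℱ : Filtration ℝ≥0 mΩ
  /-- the process -/
  X : ℝ≥0 → Ω → State S
  /-- the law of the process started from a point of `E` -/
  P : State S → Measure Ω
  isProbabilityMeasure : ∀ x, IsProbabilityMeasure (P x)
  /-- the filtration is right-continuous ... -/
  rightContinuous_filtration : ℱ.IsRightContinuous
  /-- ... and contains the sets that are null for every `P x` -/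
  complete : ∀ N M : Set Ω, MeasurableSet M → N ⊆ M → (∀ x, P x M = 0) → MeasurableSet[ℱ 0] N
  adapted : ∀ t, Measurable[ℱ t] (X t)
  /-- the transition function is Borel in the starting point -/
  measurable_transition : ∀ (t : ℝ≥0) (B : Set (State S)), MeasurableSet B →
    Measurable fun x => P x {ω | X t ω ∈ B}
  start : ∀ x, ∀ᵐ ω ∂P x, X 0 ω = x
  right_continuous : ∀ ω t, ContinuousWithinAt (fun s => X s ω) (Ici t) t
  left_limits : ∀ ω, ∀ t : ℝ≥0, 0 < t → ∃ l, Tendsto (fun s => X s ω) (𝓝[<] t) (𝓝 l)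
  /-- strong Markov property at every stopping time `T`, on the event `T < ∞` -/
  strong_markov : ∀ (T : Ω → ℝ≥0∞) (hT : IsStoppingTime ℱ T) (L : Set Ω),
    MeasurableSet[hT.measurableSpace] L → ∀ (t : ℝ≥0) (B : Set (State S)), MeasurableSet B →
    ∀ x, P x (L ∩ {ω | T ω < ∞} ∩ {ω | X ((T ω).toNNReal + t) ω ∈ B}) =
      ∫⁻ ω in L ∩ {ω | T ω < ∞}, P (X (T ω).toNNReal ω) {ω' | X t ω' ∈ B} ∂P x
  /-- quasi-left-continuity on `[0, ζ)`, where `ζ` is the lifetime -/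
  quasi_left_continuous : ∀ T : ℕ → Ω → ℝ≥0∞, (∀ k, IsStoppingTime ℱ (T k)) →
    (∀ ω, Monotone fun k => T k ω) → ∀ x, ∀ᵐ ω ∂P x,
      (⨆ k, T k ω) < exitTime X (inner S) ω →
        Tendsto (fun k => X (T k ω).toNNReal ω) atTop (𝓝 (X (⨆ k, T k ω).toNNReal ω))
  /-- absorption at `∂E` -/
  absorbed : ∀ ω (s t : ℝ≥0), s ≤ t → X s ω ∉ inner S → X t ω = X s ω
  /-- irreducibility: from any interior point every nonempty open set can be reached -/
  irreducible : ∀ x ∈ inner S, ∀ U : Set (State S), IsOpen U → U.Nonempty →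
    0 < P x {ω | ∃ t, X t ω ∈ U}

variable {n : ℕ} {S : Set (EuclideanSpace ℝ (Fin n))} {Ω : Type*} [MeasurableSpace Ω]

namespace StandardProcess

/-- The lifetime `ζ = inf {s > 0 : X_s ∉ E°}`. -/
def lifetime (Z : StandardProcess S Ω) (ω : Ω) : ℝ≥0∞ := exitTime Z.X (inner S) ω

/-- The semigroup of `X` killed when it exits `D`: `f ↦ E_x[f(X_t); t < τ_D]`. -/
def killed (Z : StandardProcess S Ω) (D : Set (State S)) (t : ℝ≥0) (f : State S → ℝ≥0∞)
    (x : State S) : ℝ≥0∞ :=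
  ∫⁻ ω in {ω | (t : ℝ≥0∞) < exitTime Z.X D ω}, f (Z.X t ω) ∂Z.P x

/-- `f` is excessive on `D`, that is, excessive for `X` killed when it exits `D`. For `D = E`
there is no killing. -/
structure ExcessiveOn (Z : StandardProcess S Ω) (D : Set (State S)) (f : State S → ℝ≥0∞) :
    Prop where
  measurable : Measurable f
  le : ∀ x ∈ D, ∀ t : ℝ≥0, Z.killed D t f x ≤ f x
  tendsto : ∀ x ∈ D, Tendsto (fun t : ℝ≥0 => Z.killed D t f x) (𝓝[>] 0) (𝓝 (f x))

end StandardProcess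

/-- The set `E_h = {x : 0 < h(x) < ∞}`. -/
def finPos (h : State S → ℝ≥0∞) : Set (State S) := {x | 0 < h x ∧ h x < ∞}

open Classical in
/-- The semigroup of the Doob `h`-transform `X^h`, killed when it exits `E°`:
`P_t^h f(x) = E_x[(h(X_t) / h(x)) f(X_t); t < τ]` for `x ∈ E_h`, where `τ` is the exit time
from `E_h ∩ E°`, and `0` for `x ∉ E_h`. -/
def StandardProcess.doob (Z : StandardProcess S Ω) (h : State S → ℝ≥0∞) (t : ℝ≥0)
    (f : State S → ℝ≥0∞) (x : State S) : ℝ≥0∞ :=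
  if x ∈ finPos h then Z.killed (finPos h ∩ inner S) t (fun y => h y / h x * f y) x else 0

/-- Finite-dimensional distributions of the (sub-)Markov process with semigroup `Q` started
from `x`. The list `[(s₁, B₁), …, (sₖ, Bₖ)]` stands for the event that at the times
`s₁, s₁ + s₂, …, s₁ + ⋯ + sₖ` the process is alive and lies in `B₁, …, Bₖ` respectively. -/
def semigroupFdd (Q : ℝ≥0 → (State S → ℝ≥0∞) → State S → ℝ≥0∞) :
    List (ℝ≥0 × Set (State S)) → State S → ℝ≥0∞
  | [], _ => 1
  | (s, B) :: l, x => Q s (B.indicator (semigroupFdd Q l)) x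

/-- The event that `Y` is alive and lies in `B₁, …, Bₖ` at the times
`u + s₁, …, u + s₁ + ⋯ + sₖ`. -/
def cylinder (Y : ℝ≥0 → Ω → State S) (alive : ℝ≥0 → Ω → Prop) :
    List (ℝ≥0 × Set (State S)) → ℝ≥0 → Set Ω
  | [], _ => univ
  | (s, B) :: l, u => {ω | alive (u + s) ω ∧ Y (u + s) ω ∈ B} ∩ cylinder Y alive l (u + s)

namespace StandardProcess

/-- The additive functional `A_t = ∫₀ᵗ v(X_s)⁻¹ ds`. -/
def additive (Z : StandardProcess S Ω) (v : State S → ℝ) (t : ℝ≥0) (ω : Ω) : ℝ≥0∞ :=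
  ∫⁻ s in Ioc (0 : ℝ) t, ENNReal.ofReal (v (Z.X s.toNNReal ω))⁻¹

/-- Its inverse `γ_t = inf {s : A_s > t}`. -/
def clock (Z : StandardProcess S Ω) (v : State S → ℝ) (t : ℝ≥0) (ω : Ω) : ℝ≥0∞ :=
  ⨅ (s : ℝ≥0) (_ : (t : ℝ≥0∞) < Z.additive v s ω), (s : ℝ≥0∞)

/-- `X` has the Inversion Property with characteristics `(I, h, v)`: under every `P x` the
process `I(X_{γ_t})`, alive while `γ_t < ζ`, has the law of the process `X^h` started from
`I(x)`. Equality in law means equality of all finite-dimensional distributions. -/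
structure HasIP (Z : StandardProcess S Ω) (I : State S → State S) (h : State S → ℝ≥0∞)
    (v : State S → ℝ) : Prop where
  involutive : Function.Involutive I
  ne_id : I ≠ id
  measurable : Measurable I
  excessive : Z.ExcessiveOn univ h
  inner_subset : inner S ⊆ finPos h
  v_pos : ∀ x ∈ inner S, 0 < v x
  v_continuous : ContinuousOn v (inner S)
  law : ∀ (x : State S) (l : List (ℝ≥0 × Set (State S))), (∀ p ∈ l, MeasurableSet p.2) →
    Z.P x (cylinder (fun t ω => I (Z.X (Z.clock v t ω).toNNReal ω))
      (fun t ω => Z.clock v t ω < Z.lifetime ω) l 0) = semigroupFdd (Z.doob h) l (I x)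

end StandardProcess

end Inversion

end

/-! Write K = h · (H ∘ I). The inversion property turns the expectation of K along X from x, with X
confined to a set C, into h(x) times the expectation from I(x) of H at the random time γ_t, with the
time-changed path I(X_γ) confined to C. Since H is excessive on D, H(X) is a supermartingale while X
stays in a closed subset of D. Optional stopping at γ_t bounds the latter expectation by H(I(x)),
which gives E_x[K(X_t); X stays in C] ≤ K(x) for compact C (`HasIP.setLIntegral_stays_le`).

The inversion property only compares finite-dimensional distributions, so confinement is tested at
dyadic times and the grid is then refined. For X itself, right-continuity suffices. For the
time-changed path, the additive functional A is strictly increasing before the lifetime, so the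
times γ_q with q dyadic are dense enough to control the whole path of X up to γ_t
(`mem_of_le_clock`). The refinement is a decreasing limit of integrals, which needs finiteness.
Hence H is first replaced by its minimum with an integer N, and N → ∞ at the end. Optional stopping
(`ExcessiveOn.setLIntegral_stopped_le`) approximates γ_t from the right by grid times and uses Fatou
and the continuity of H.

To pass from compact sets to I(D), exhaust I(D) ∩ E° by compacts. Quasi-left-continuity forces a
path that has not left this open set by time t to have stayed in one of them (`ae_exists_stays`).
Outside E° the function K vanishes, because I preserves E° (`HasIP.map_mem_inner`). The limit at t =
0 follows from this upper bound together with Fatou and the continuity of K on I(D) ∩ E°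
(`tendsto_killed`). -/

namespace OnePoint

/-! ### Topology of the state space, dyadic times, joint measurability. -/

/-- The one-point compactification of a second countable locally compact Hausdorff space is
second countable. -/
theorem secondCountableTopology (X : Type*) [TopologicalSpace X] [T2Space X]
    [LocallyCompactSpace X] [SecondCountableTopology X] :
    SecondCountableTopology (OnePoint X) := by
  let K : CompactExhaustion X := default
  set b : Set (Set (OnePoint X)) :=
    (fun s : Set X => ((↑) : X → OnePoint X) '' s) '' TopologicalSpace.countableBasis X ∪
      range fun n => (((↑) : X → OnePoint X) '' K n)ᶜ
  have hb : TopologicalSpace.IsTopologicalBasis b := by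
    refine TopologicalSpace.isTopologicalBasis_of_isOpen_of_nhds ?_ ?_
    · rintro u (⟨s, hs, rfl⟩ | ⟨n, rfl⟩)
      · exact isOpen_image_coe.2 (TopologicalSpace.isOpen_of_mem_countableBasis hs)
      · exact isOpen_compl_image_coe.2 ⟨(K.isCompact n).isClosed, K.isCompact n⟩
    · intro a u ha hu
      induction a using OnePoint.rec with
      | infty =>
        obtain ⟨n, hn⟩ := K.exists_superset_of_isCompact
          ((isOpen_iff_of_mem ha).1 hu).2
        refine ⟨_, Or.inr ⟨n, rfl⟩, infty_notMem_image_coe, ?_⟩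
        intro z hz
        induction z using OnePoint.rec with
        | infty => exact ha
        | coe z =>
          by_contra hzu
          exact hz ⟨z, hn hzu, rfl⟩
      | coe a =>
        obtain ⟨s, hs, has, hsu⟩ :=
          (TopologicalSpace.isBasis_countableBasis X).exists_subset_of_mem_open
            (show a ∈ ((↑) : X → OnePoint X) ⁻¹' u from ha) (hu.preimage continuous_coe)
        exact ⟨_, Or.inl ⟨s, hs, rfl⟩, ⟨a, has, rfl⟩, image_subset_iff.2 hsu⟩
  exact hb.secondCountableTopology
    (((TopologicalSpace.countable_countableBasis X).image _).union (countable_range _))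

end OnePoint

/-- An open subset of a second countable locally compact space is exhausted by compact sets. -/
theorem IsOpen.exists_compact_exhaustion {X : Type*} [TopologicalSpace X]
    [T2Space X] [LocallyCompactSpace X] [SecondCountableTopology X] {U : Set X} (hU : IsOpen U) :
    ∃ C : ℕ → Set X, (∀ k, IsCompact (C k)) ∧ (∀ k, C k ⊆ interior (C (k + 1))) ∧
      ⋃ k, C k = U := by
  have := hU.locallyCompactSpace
  let K : CompactExhaustion U := default
  refine ⟨fun k => Subtype.val '' K k, fun k => (K.isCompact k).image continuous_subtype_val,
    fun k => ?_, ?_⟩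
  · exact (image_mono (K.subset_interior_succ k)).trans
      (hU.isOpenMap_subtype_val.image_interior_subset _)
  · rw [← image_iUnion, K.iUnion_eq, image_univ, Subtype.range_coe]

/-- Rounding up to the grid of mesh 1/(n+1) approaches u from the right, the only side on which the
paths are continuous. It serves both for joint measurability and for discretising stopping times. -/
theorem NNReal.tendsto_floor_succ_div (u : ℝ≥0) :
    Tendsto (fun n : ℕ => ((⌊u * (n + 1 : ℕ)⌋₊ + 1 : ℕ) / (n + 1 : ℕ) : ℝ≥0)) atTop (𝓝[≥] u) := by
  have hlow : ∀ n : ℕ, u ≤ ((⌊u * (n + 1 : ℕ)⌋₊ + 1 : ℕ) / (n + 1 : ℕ) : ℝ≥0) := by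
    intro n
    rw [le_div_iff₀ (by positivity)]
    exact_mod_cast (Nat.lt_floor_add_one (u * (n + 1 : ℕ))).le
  refine tendsto_nhdsWithin_iff.2 ⟨?_, Eventually.of_forall hlow⟩
  have hlim : Tendsto (fun n : ℕ => u + 1 / ((n : ℝ≥0) + 1)) atTop (𝓝 u) := by
    have := tendsto_one_div_add_atTop_nhds_zero_nat (𝕜 := ℝ≥0)
    simpa using this.const_add u
  refine tendsto_of_tendsto_of_tendsto_of_le_of_le tendsto_const_nhds hlim hlow fun n => ?_
  rw [div_le_iff₀ (by positivity)]
  have := Nat.floor_le (zero_le (a := u * (n + 1 : ℕ)))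
  have h3 : (u + 1 / ((n : ℝ≥0) + 1)) * ((n + 1 : ℕ) : ℝ≥0) = u * (n + 1 : ℕ) + 1 := by
    push_cast
    rw [add_mul, one_div, inv_mul_cancel₀ (by positivity)]
  rw [h3]
  push_cast at this ⊢
  gcongr

/-- A jointly measurable version of a right-continuous process. -/
theorem measurable_uncurry_of_right_continuous {Ω E : Type*} [MeasurableSpace Ω]
    [TopologicalSpace E] [TopologicalSpace.PseudoMetrizableSpace E] [MeasurableSpace E]
    [BorelSpace E] {Y : ℝ≥0 → Ω → E} (hY : ∀ s, Measurable (Y s))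
    (hrc : ∀ ω t, ContinuousWithinAt (fun s => Y s ω) (Ici t) t) :
    Measurable fun p : ℝ≥0 × Ω => Y p.1 p.2 := by
  refine measurable_of_tendsto_metrizable
    (f := fun (n : ℕ) (p : ℝ≥0 × Ω) => Y ((⌊p.1 * (n + 1 : ℕ)⌋₊ + 1 : ℕ) / (n + 1 : ℕ)) p.2)
    (fun n => ?_) ?_
  · have h1 : Measurable fun q : ℕ × Ω => Y ((q.1 + 1 : ℕ) / (n + 1 : ℕ)) q.2 :=
      measurable_from_prod_countable_right fun k => hY ((k + 1 : ℕ) / (n + 1 : ℕ))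
    have h2 : Measurable fun p : ℝ≥0 × Ω => (⌊p.1 * (n + 1 : ℕ)⌋₊, p.2) :=
      (Nat.measurable_floor.comp (measurable_fst.mul_const _)).prodMk measurable_snd
    exact h1.comp h2
  · rw [tendsto_pi_nhds]
    rintro ⟨u, ω⟩
    exact Tendsto.comp (hrc ω u) (NNReal.tendsto_floor_succ_div u)

/-- Between two points of `[0, t]` lies a dyadic fraction of `t`. -/
theorem NNReal.exists_dyadic_mul_mem_Ioo {a b t : ℝ≥0} (hab : a < b) (hbt : b ≤ t) :
    ∃ m j : ℕ, j ≤ 2 ^ m ∧ a < j * (t / 2 ^ m) ∧ j * (t / 2 ^ m) < b := by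
  have ht : 0 < t := (zero_le (a := a)).trans_lt (hab.trans_le hbt)
  obtain ⟨m, hm⟩ : ∃ m : ℕ, t / 2 ^ m < b - a := by
    obtain ⟨m, hm⟩ := exists_pow_lt_of_lt_one (div_pos (tsub_pos_of_lt hab) ht)
      (show (2⁻¹ : ℝ≥0) < 1 from inv_lt_one_of_one_lt₀ (by norm_num))
    refine ⟨m, ?_⟩
    rw [lt_div_iff₀ ht] at hm
    rwa [inv_pow, mul_comm, ← div_eq_mul_inv] at hm
  set d := t / 2 ^ m with hd
  have hd0 : 0 < d := by positivity
  have h1 : a < (⌊a / d⌋₊ + 1 : ℕ) * d := by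
    rw [← div_lt_iff₀ hd0]
    exact_mod_cast Nat.lt_floor_add_one _
  have h2 : ((⌊a / d⌋₊ + 1 : ℕ) : ℝ≥0) * d < b := by
    have h3 : (⌊a / d⌋₊ : ℝ≥0) * d ≤ a := by
      rw [← le_div_iff₀ hd0]
      exact Nat.floor_le zero_le
    calc ((⌊a / d⌋₊ + 1 : ℕ) : ℝ≥0) * d = (⌊a / d⌋₊ : ℝ≥0) * d + d := by push_cast; ring
      _ ≤ a + d := by gcongr
      _ < a + (b - a) := by gcongr
      _ = b := add_tsub_cancel_of_le hab.le
  refine ⟨m, _, ?_, h1, h2⟩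
  have h4 : ((⌊a / d⌋₊ + 1 : ℕ) : ℝ≥0) * d < (2 ^ m : ℕ) * d := by
    refine (h2.trans_le hbt).trans_eq ?_
    rw [hd]; push_cast; field_simp
  exact_mod_cast (lt_of_mul_lt_mul_right h4 hd0.le).le

/-- A right-continuous path which lies in a closed set at all dyadic fractions of `t` lies in it
throughout `[0, t]`. -/
theorem mem_of_forall_dyadic {E : Type*} [TopologicalSpace E] {C : Set E} (hC : IsClosed C)
    {f : ℝ≥0 → E} (hf : ∀ t, ContinuousWithinAt f (Ici t) t) {t : ℝ≥0}
    (h : ∀ m j : ℕ, j ≤ 2 ^ m → f (j * (t / 2 ^ m)) ∈ C) {s : ℝ≥0} (hs : s ≤ t) : f s ∈ C := by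
  rcases hs.eq_or_lt with rfl | hlt
  · simpa using h 0 1 (by norm_num)
  by_contra hsC
  have h1 : ∀ᶠ r in 𝓝[≥] s, f r ∉ C := (hf s).eventually (hC.isOpen_compl.mem_nhds hsC)
  obtain ⟨u, hu, hu'⟩ := (mem_nhdsGE_iff_exists_Ico_subset' hlt).1 h1
  obtain ⟨m, j, hj, hj1, hj2⟩ :=
    NNReal.exists_dyadic_mul_mem_Ioo (lt_min hu hlt) (min_le_right u t)
  exact hu' ⟨hj1.le, hj2.trans_le (min_le_left _ _)⟩ (h m j hj)

theorem measurable_setLIntegral_of_right_continuous {Ω E : Type*} [MeasurableSpace Ω]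
    [TopologicalSpace E] [TopologicalSpace.PseudoMetrizableSpace E] [MeasurableSpace E]
    [BorelSpace E] {Y : ℝ≥0 → Ω → E} (hY : ∀ s, Measurable (Y s))
    (hrc : ∀ ω t, ContinuousWithinAt (fun s => Y s ω) (Ici t) t) {g : E → ℝ≥0∞}
    (hg : Measurable g) (A : Set ℝ) :
    Measurable fun ω => ∫⁻ r in A, g (Y r.toNNReal ω) :=
  Measurable.lintegral_prod_left (hg.comp ((measurable_uncurry_of_right_continuous hY hrc).comp
    ((measurable_real_toNNReal.comp measurable_fst).prodMk measurable_snd)))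

noncomputable section

namespace Inversion

variable {n : ℕ} {S : Set (EuclideanSpace ℝ (Fin n))} {Ω : Type*}

theorem isOpen_inner : IsOpen (inner S) :=
  OnePoint.isOpen_image_coe.2
    ((isOpen_interior.sdiff isClosed_singleton).preimage continuous_subtype_val)

theorem secondCountableTopology_state [LocallyCompactSpace S] :
    SecondCountableTopology (State S) :=
  OnePoint.secondCountableTopology S

theorem metrizableSpace_state [LocallyCompactSpace S] :
    TopologicalSpace.MetrizableSpace (State S) := by
  have := secondCountableTopology_state (S := S)
  infer_instance

/-! ### Exit times of right-continuous paths. -/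

section exitTime

variable {α : Type*} {X : ℝ≥0 → Ω → α} {D : Set α} {ω : Ω}

theorem mem_of_lt_exitTime {t s : ℝ≥0} (h : (t : ℝ≥0∞) < exitTime X D ω) (h0 : 0 < s)
    (hs : s ≤ t) : X s ω ∈ D := by
  by_contra hD
  exact absurd (h.trans_le (iInf₂_le s ⟨h0, hD⟩)) (not_lt.2 (by exact_mod_cast hs))

theorem exitTime_lt_iff {c : ℝ≥0∞} :
    exitTime X D ω < c ↔ ∃ s : ℝ≥0, (0 < s ∧ X s ω ∉ D) ∧ (s : ℝ≥0∞) < c := by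
  simp only [exitTime, iInf_lt_iff, exists_prop]

theorem exitTime_mono {D' : Set α} (h : D ⊆ D') : exitTime X D ω ≤ exitTime X D' ω :=
  iInf_mono fun _ => iInf_mono' fun hs => ⟨⟨hs.1, fun hD => hs.2 (h hD)⟩, le_rfl⟩

variable [TopologicalSpace α]

/-- Openness of D and right-continuity at t keep the path in D slightly beyond t, which makes the
inequality strict. -/
theorem lt_exitTime_of_isOpen (hD : IsOpen D) {t : ℝ≥0}
    (hX : ContinuousWithinAt (fun s => X s ω) (Ici t) t) (h : ∀ s ≤ t, X s ω ∈ D) :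
    (t : ℝ≥0∞) < exitTime X D ω := by
  obtain ⟨u, hu, hu'⟩ := (mem_nhdsGE_iff_exists_Ico_subset' (lt_add_one t)).1
    (hX.eventually (hD.mem_nhds (h t le_rfl)))
  refine (ENNReal.coe_lt_coe.2 (show t < u from hu)).trans_le (le_iInf₂ fun s hs => ?_)
  rw [ENNReal.coe_le_coe]
  by_contra! hsu
  rcases le_total s t with hst | hst
  · exact hs.2 (h s hst)
  · exact hs.2 (hu' ⟨hst, hsu⟩)

/-- The exit time ignores time 0. For closed D nothing is lost: a path starting outside D would
remain outside for small positive times. -/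
theorem mem_of_lt_exitTime_of_isClosed (hD : IsClosed D)
    (hX : ContinuousWithinAt (fun s => X s ω) (Ici 0) 0) {t s : ℝ≥0}
    (h : (t : ℝ≥0∞) < exitTime X D ω) (hs : s ≤ t) : X s ω ∈ D := by
  rcases (zero_le (a := s)).eq_or_lt with rfl | h0
  · by_contra h0D
    obtain ⟨u, hu, hu'⟩ := (mem_nhdsGE_iff_exists_Ico_subset' (zero_lt_one (α := ℝ≥0))).1
      (hX.eventually (hD.isOpen_compl.mem_nhds h0D))
    obtain ⟨r, hr0, hr⟩ : ∃ r : ℝ≥0, 0 < r ∧ r < u ∧ (r : ℝ≥0∞) < exitTime X D ω := by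
      have h1 : (0 : ℝ≥0∞) < min (u : ℝ≥0∞) (exitTime X D ω) :=
        lt_min (by exact_mod_cast hu) (lt_of_le_of_lt zero_le h)
      obtain ⟨r, hr0, hr⟩ := ENNReal.lt_iff_exists_nnreal_btwn.1 h1
      exact ⟨r, by exact_mod_cast hr0, by exact_mod_cast hr.trans_le (min_le_left _ _),
        hr.trans_le (min_le_right _ _)⟩
    exact hu' ⟨zero_le, hr.1⟩ (mem_of_lt_exitTime hr.2 hr0 le_rfl)
  · exact mem_of_lt_exitTime h h0 hs

/-- At its (finite) exit time from a set, a right-continuous path is not in the interior. -/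
theorem notMem_interior_of_exitTime_eq {t : ℝ≥0}
    (hX : ContinuousWithinAt (fun s => X s ω) (Ici t) t)
    (h : exitTime X D ω = t) : X t ω ∉ interior D := by
  intro hD
  obtain ⟨u, hu, hu'⟩ := (mem_nhdsGE_iff_exists_Ico_subset' (lt_add_one t)).1
    (hX.eventually (isOpen_interior.mem_nhds hD))
  obtain ⟨s, hs, hsu⟩ := exitTime_lt_iff.1
    (h.trans_lt (ENNReal.coe_lt_coe.2 (show t < u from hu)))
  refine hs.2 (interior_subset (hu' ⟨?_, by exact_mod_cast hsu⟩))
  have : exitTime X D ω ≤ s := iInf₂_le s hs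
  rw [h] at this
  exact_mod_cast this

end exitTime

/-! ### Absorption, and events of staying in a closed set. -/

namespace StandardProcess

variable [MeasurableSpace Ω] (Z : StandardProcess S Ω)

instance (x : State S) : IsProbabilityMeasure (Z.P x) := Z.isProbabilityMeasure x

theorem measurable_X (t : ℝ≥0) : Measurable (Z.X t) := (Z.adapted t).mono (Z.ℱ.le t) le_rfl

variable {Z}

theorem mem_inner_of_le {ω : Ω} {s t : ℝ≥0} (hst : s ≤ t) (h : Z.X t ω ∈ inner S) :
    Z.X s ω ∈ inner S := by
  by_contra hs
  exact hs (Z.absorbed ω s t hst hs ▸ h)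

/-- By absorption, being alive at time t depends only on the position at time t. This makes killing
at the lifetime compatible with finite-dimensional distributions. -/
theorem lt_exitTime_inner_iff {ω : Ω} {t : ℝ≥0} :
    (t : ℝ≥0∞) < exitTime Z.X (inner S) ω ↔ Z.X t ω ∈ inner S := by
  refine ⟨fun h => ?_, fun h => lt_exitTime_of_isOpen isOpen_inner (Z.right_continuous ω t)
    fun s hs => mem_inner_of_le hs h⟩
  obtain ⟨r, hr, hr'⟩ := ENNReal.lt_iff_exists_nnreal_btwn.1 h
  have hr : t < r := by exact_mod_cast hr
  exact mem_inner_of_le hr.le (mem_of_lt_exitTime hr' (hr.trans_le' zero_le) le_rfl)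

variable (Z)

theorem setLIntegral_X_zero (x : State S) (A : Set (State S)) (hA : MeasurableSet A)
    (f : State S → ℝ≥0∞) :
    ∫⁻ ω in {ω | Z.X 0 ω ∈ A}, f (Z.X 0 ω) ∂Z.P x = A.indicator f x := by
  have hm : MeasurableSet {ω | Z.X 0 ω ∈ A} := Z.measurable_X 0 hA
  rw [← lintegral_indicator hm]
  calc ∫⁻ ω, {ω | Z.X 0 ω ∈ A}.indicator (fun ω => f (Z.X 0 ω)) ω ∂Z.P x
      = ∫⁻ _, A.indicator f x ∂Z.P x := by
        refine lintegral_congr_ae ?_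
        filter_upwards [Z.start x] with ω hω
        by_cases hx : x ∈ A <;> simp [indicator, hω, hx]
    _ = A.indicator f x := by simp

/-- The event that the path stays in `C` throughout `[0, t]`. -/
def stays (C : Set (State S)) (t : ℝ≥0) : Set Ω := {ω | ∀ s ≤ t, Z.X s ω ∈ C}

/-- The event that the path is in `C` at the times `u + j t / 2 ^ m`, `j ≤ 2 ^ m`. -/
def dyadicStays (C : Set (State S)) (u t : ℝ≥0) (m : ℕ) : Set Ω :=
  {ω | ∀ j : ℕ, j ≤ 2 ^ m → Z.X (u + j * (t / 2 ^ m)) ω ∈ C}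

theorem dyadic_le {t : ℝ≥0} {m j : ℕ} (hj : j ≤ 2 ^ m) : j * (t / 2 ^ m) ≤ t := by
  calc (j : ℝ≥0) * (t / 2 ^ m) ≤ (2 ^ m : ℕ) * (t / 2 ^ m) := by gcongr
    _ = t := by push_cast; field_simp

theorem dyadic_succ (t : ℝ≥0) (m j : ℕ) :
    ((2 * j : ℕ) : ℝ≥0) * (t / 2 ^ (m + 1)) = j * (t / 2 ^ m) := by
  push_cast; rw [pow_succ]; field_simp

theorem antitone_dyadicStays (C : Set (State S)) (u t : ℝ≥0) :
    Antitone (Z.dyadicStays C u t) := by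
  refine antitone_nat_of_succ_le fun m ω hω j hj => ?_
  have := hω (2 * j) (by rw [pow_succ]; omega)
  rwa [dyadic_succ] at this

/-- Dyadic tests detect every excursion into the open complement of C, since by right-continuity
such an excursion lasts for an interval of time. -/
theorem iInter_dyadicStays {C : Set (State S)} (hC : IsClosed C) (u t : ℝ≥0) :
    ⋂ m, Z.dyadicStays C u t m = {ω | ∀ s ≤ t, Z.X (u + s) ω ∈ C} := by
  ext ω
  simp only [mem_iInter, dyadicStays, mem_ofPred_eq]
  refine ⟨fun h s hs => ?_, fun h m j hj => h _ (dyadic_le hj)⟩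
  refine mem_of_forall_dyadic hC (f := fun s => Z.X (u + s) ω) (fun r => ?_)
    (fun m j hj => h m j hj) hs
  exact (Z.right_continuous ω (u + r)).comp (t := Ici (u + r)) (by fun_prop)
    fun q hq => add_le_add_right (mem_Ici.1 hq) u

theorem measurableSet_dyadicStays {C : Set (State S)} (hC : MeasurableSet C) (u t : ℝ≥0) (m : ℕ) :
    MeasurableSet[Z.ℱ (u + t)] (Z.dyadicStays C u t m) := by
  have : Z.dyadicStays C u t m = ⋂ j : ℕ, ⋂ (_ : j ≤ 2 ^ m), Z.X (u + j * (t / 2 ^ m)) ⁻¹' C := by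
    ext ω; simp [dyadicStays]
  rw [this]
  refine MeasurableSet.iInter fun j => MeasurableSet.iInter fun hj => ?_
  exact Z.ℱ.mono (add_le_add_right (dyadic_le hj) u) _ (Z.adapted _ hC)

theorem measurableSet_stays {C : Set (State S)} (hC : IsClosed C) (t : ℝ≥0) :
    MeasurableSet[Z.ℱ t] (Z.stays C t) := by
  have : Z.stays C t = ⋂ m, Z.dyadicStays C 0 t m := by
    rw [Z.iInter_dyadicStays hC]; simp [stays]
  rw [this]
  refine MeasurableSet.iInter fun m => ?_
  have := Z.measurableSet_dyadicStays hC.measurableSet 0 t m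
  rwa [zero_add] at this

/-! ### The Markov property -/

theorem measurable_map_X (t : ℝ≥0) : Measurable fun x => (Z.P x).map (Z.X t) := by
  refine Measure.measurable_of_measurable_coe _ fun B hB => ?_
  simp_rw [Measure.map_apply (Z.measurable_X t) hB]
  exact Z.measurable_transition t B hB

theorem measurable_lintegral_X {f : State S → ℝ≥0∞} (hf : Measurable f) (t : ℝ≥0) :
    Measurable fun x => ∫⁻ ω, f (Z.X t ω) ∂Z.P x := by
  have := (Measure.measurable_lintegral hf).comp (Z.measurable_map_X t)
  simpa only [Function.comp_def, lintegral_map hf (Z.measurable_X t)] using this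

/-- This is the strong Markov property at the constant time s, extended from indicators to functions
by viewing it as an identity of measures on the state space. -/
theorem setLIntegral_X_add {A : Set Ω} {s : ℝ≥0} (hA : MeasurableSet[Z.ℱ s] A) (t : ℝ≥0)
    {f : State S → ℝ≥0∞} (hf : Measurable f) (x : State S) :
    ∫⁻ ω in A, f (Z.X (s + t) ω) ∂Z.P x =
      ∫⁻ ω in A, ∫⁻ ω', f (Z.X t ω') ∂Z.P (Z.X s ω) ∂Z.P x := by
  have key : ((Z.P x).restrict A).map (Z.X (s + t)) =
      (((Z.P x).restrict A).map (Z.X s)).bind fun z => (Z.P z).map (Z.X t) := by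
    ext B hB
    rw [Measure.map_apply (Z.measurable_X _) hB,
      Measure.bind_apply hB (Z.measurable_map_X t).aemeasurable,
      Measure.restrict_apply (Z.measurable_X _ hB)]
    simp_rw [Measure.map_apply (Z.measurable_X t) hB]
    rw [lintegral_map (show Measurable fun z => Z.P z (Z.X t ⁻¹' B) from
      Z.measurable_transition t B hB) (Z.measurable_X s)]
    have hT := isStoppingTime_const Z.ℱ s
    have hA' : MeasurableSet[hT.measurableSpace] A := by
      rwa [IsStoppingTime.measurableSpace_const]
    have := Z.strong_markov (fun _ => ((s : ℝ≥0) : ℝ≥0∞)) hT A hA' t B hB x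
    simp only [ENNReal.coe_lt_top, ofPred_true, inter_univ, ENNReal.toNNReal_coe] at this
    rw [inter_comm]
    exact this
  rw [← lintegral_map hf (Z.measurable_X _), key,
    Measure.lintegral_bind (Z.measurable_map_X t).aemeasurable hf.aemeasurable]
  simp_rw [lintegral_map hf (Z.measurable_X t)]
  rw [lintegral_map (Z.measurable_lintegral_X hf t) (Z.measurable_X s)]

/-- Expectation of `f` at the last time of a list of time increments, on the event that the
process visits the prescribed sets (and `G`) at these times. -/
def markovFdd (G : Set (State S)) (f : State S → ℝ≥0∞) :
    List (ℝ≥0 × Set (State S)) → State S → ℝ≥0∞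
  | [], x => f x
  | (s, B) :: l, x => ∫⁻ ω, (G ∩ B).indicator (markovFdd G f l) (Z.X s ω) ∂Z.P x

variable {Z}

theorem measurable_markovFdd {G : Set (State S)} (hG : MeasurableSet G) {f : State S → ℝ≥0∞}
    (hf : Measurable f) : ∀ l : List (ℝ≥0 × Set (State S)), (∀ p ∈ l, MeasurableSet p.2) →
      Measurable (Z.markovFdd G f l)
  | [], _ => hf
  | (s, B) :: l, hl => Z.measurable_lintegral_X
      ((measurable_markovFdd hG hf l fun p hp => hl p (List.mem_cons_of_mem _ hp)).indicator
        (hG.inter (hl (s, B) List.mem_cons_self))) s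

/-- The Markov property at several times. -/
theorem setLIntegral_cylinder {G : Set (State S)} (hG : MeasurableSet G) {f : State S → ℝ≥0∞}
    (hf : Measurable f) (l : List (ℝ≥0 × Set (State S))) (hl : ∀ p ∈ l, MeasurableSet p.2)
    (u : ℝ≥0) {A : Set Ω} (hA : MeasurableSet[Z.ℱ u] A) (x : State S) :
    ∫⁻ ω in A ∩ cylinder Z.X (fun t ω => Z.X t ω ∈ G) l u, f (Z.X (u + (l.map Prod.fst).sum) ω)
      ∂Z.P x = ∫⁻ ω in A, Z.markovFdd G f l (Z.X u ω) ∂Z.P x := by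
  induction l generalizing u A with
  | nil => simp [cylinder, markovFdd]
  | cons p l ih =>
    obtain ⟨s, B⟩ := p
    have hB : MeasurableSet B := hl (s, B) List.mem_cons_self
    have hl' : ∀ p ∈ l, MeasurableSet p.2 := fun p hp => hl p (List.mem_cons_of_mem _ hp)
    have hGB : MeasurableSet[Z.ℱ (u + s)] (Z.X (u + s) ⁻¹' (G ∩ B)) :=
      Z.adapted _ (hG.inter hB)
    have hA' : MeasurableSet[Z.ℱ (u + s)] (A ∩ Z.X (u + s) ⁻¹' (G ∩ B)) :=
      (Z.ℱ.mono le_self_add _ hA).inter hGB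
    have hset : A ∩ cylinder Z.X (fun t ω => Z.X t ω ∈ G) ((s, B) :: l) u =
        A ∩ Z.X (u + s) ⁻¹' (G ∩ B) ∩ cylinder Z.X (fun t ω => Z.X t ω ∈ G) l (u + s) := by
      rw [inter_assoc]; rfl
    have hg := (measurable_markovFdd (Z := Z) hG hf l hl').indicator (hG.inter hB)
    simp only [markovFdd]
    rw [← Z.setLIntegral_X_add hA s hg, hset, List.map_cons, List.sum_cons, ← add_assoc, ih hl' _ hA',
      inter_comm A, ← Measure.restrict_restrict (Z.ℱ.le _ _ hGB),
      ← lintegral_indicator (Z.ℱ.le _ _ hGB)]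
    rfl

end StandardProcess

end Inversion

end

theorem MeasureTheory.iInf_setLIntegral_of_antitone {α : Type*} [MeasurableSpace α]
    {μ : Measure α} {s : ℕ → Set α} (hs : Antitone s) (hm : ∀ n, MeasurableSet (s n))
    {f : α → ℝ≥0∞} (hf : ∫⁻ a, f a ∂μ ≠ ∞) :
    ⨅ n, ∫⁻ a in s n, f a ∂μ = ∫⁻ a in ⋂ n, s n, f a ∂μ := by
  have : IsFiniteMeasure (μ.withDensity f) := isFiniteMeasure_withDensity hf
  rw [← withDensity_apply f (MeasurableSet.iInter hm), hs.measure_iInter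
    (fun n => (hm n).nullMeasurableSet) ⟨0, measure_ne_top _ _⟩]
  exact iInf_congr fun n => (withDensity_apply f (hm n)).symm

noncomputable section

namespace Inversion

variable {n : ℕ} {S : Set (EuclideanSpace ℝ (Fin n))} {Ω : Type*}

/-! ### Cylinder events along dyadic grids. -/

section cylinder

variable {Y : ℝ≥0 → Ω → State S} {alive : ℝ≥0 → Ω → Prop}

theorem cylinder_append (l l' : List (ℝ≥0 × Set (State S))) (u : ℝ≥0) :
    cylinder Y alive (l ++ l') u =
      cylinder Y alive l u ∩ cylinder Y alive l' (u + (l.map Prod.fst).sum) := by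
  induction l generalizing u with
  | nil => simp [cylinder]
  | cons p l ih => simp only [List.cons_append, cylinder, ih, List.map_cons, List.sum_cons,
      inter_assoc, add_assoc]

theorem mem_cylinder_replicate {k : ℕ} {d u : ℝ≥0} {B : Set (State S)} {ω : Ω} :
    ω ∈ cylinder Y alive (List.replicate k (d, B)) u ↔
      ∀ j : ℕ, 1 ≤ j → j ≤ k → alive (u + j * d) ω ∧ Y (u + j * d) ω ∈ B := by
  induction k generalizing u with
  | zero =>
    simp only [List.replicate_zero, cylinder, mem_univ, true_iff]
    intro j h1 h2
    omega
  | succ k ih =>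
    have h : ∀ j : ℕ, u + d + j * d = u + (j + 1 : ℕ) * d := fun j => by push_cast; ring
    simp only [List.replicate_succ, cylinder, mem_inter_iff, ih, h, mem_ofPred_eq]
    constructor
    · rintro ⟨h1, h2⟩ j hj hjk
      rcases hj.eq_or_lt with rfl | hj
      · simpa using h1
      · simpa [Nat.sub_add_cancel hj.le] using h2 (j - 1) (by omega) (by omega)
    · exact fun h => ⟨by simpa using h 1 le_rfl (by omega),
        fun j hj hjk => h (j + 1) (by omega) (by omega)⟩

/-- Time increments for the visits to `C` at the dyadic fractions `j t / 2 ^ m` of `t`. -/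
def dyadicVisits (C : Set (State S)) (t : ℝ≥0) (m : ℕ) : List (ℝ≥0 × Set (State S)) :=
  -- The zero increment tests the initial time, so the grid has 2 ^ m + 1 points.
  (0, C) :: List.replicate (2 ^ m) (t / 2 ^ m, C)

theorem sum_dyadicVisits (C : Set (State S)) (t : ℝ≥0) (m : ℕ) :
    ((dyadicVisits C t m).map Prod.fst).sum = t := by
  simp only [dyadicVisits, List.map_cons, List.map_replicate, List.sum_cons, List.sum_replicate,
    zero_add, nsmul_eq_mul]
  push_cast
  field_simp

theorem measurableSet_of_mem_dyadicVisits {C : Set (State S)} (hC : MeasurableSet C) {t : ℝ≥0}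
    {m : ℕ} {p : ℝ≥0 × Set (State S)} (hp : p ∈ dyadicVisits C t m) : MeasurableSet p.2 := by
  simp only [dyadicVisits, List.mem_cons, List.mem_replicate] at hp
  rcases hp with rfl | ⟨-, rfl⟩ <;> exact hC

theorem mem_cylinder_dyadicVisits {C : Set (State S)} {t u : ℝ≥0} {m : ℕ} {ω : Ω} :
    ω ∈ cylinder Y alive (dyadicVisits C t m) u ↔ ∀ j : ℕ, j ≤ 2 ^ m →
      alive (u + j * (t / 2 ^ m)) ω ∧ Y (u + j * (t / 2 ^ m)) ω ∈ C := by
  simp only [dyadicVisits, cylinder, mem_inter_iff, mem_cylinder_replicate, add_zero,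
    mem_ofPred_eq]
  constructor
  · rintro ⟨h1, h2⟩ j hj
    rcases j.eq_zero_or_pos with rfl | h0
    · simpa using h1
    · exact h2 j h0 hj
  · exact fun h => ⟨by simpa using h 0 (Nat.zero_le _), fun j _ hj => h j hj⟩

end cylinder

namespace StandardProcess

variable [MeasurableSpace Ω] {Z : StandardProcess S Ω}

/-- The finite-dimensional distributions of the Doob transform, in terms of the process. -/
theorem mul_semigroupFdd_doob {h : State S → ℝ≥0∞} (hh : inner S ⊆ finPos h)
    (l : List (ℝ≥0 × Set (State S))) (hl : ∀ p ∈ l, MeasurableSet p.2) {x : State S}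
    (hx : x ∈ inner S) :
    h x * semigroupFdd (Z.doob h) l x = Z.markovFdd (inner S) h l x := by
  induction l generalizing x with
  | nil => simp [semigroupFdd, markovFdd]
  | cons p l ih =>
    obtain ⟨s, B⟩ := p
    have hB : MeasurableSet B := hl (s, B) List.mem_cons_self
    have hl' : ∀ p ∈ l, MeasurableSet p.2 := fun p hp => hl p (List.mem_cons_of_mem _ hp)
    have hset : {ω | (s : ℝ≥0∞) < exitTime Z.X (finPos h ∩ inner S) ω} =
        Z.X s ⁻¹' inner S := by
      rw [inter_eq_right.2 hh]
      ext ω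
      exact lt_exitTime_inner_iff
    have hm : MeasurableSet (Z.X s ⁻¹' inner S) := Z.measurable_X s isOpen_inner.measurableSet
    simp only [semigroupFdd, doob, if_pos (hh hx), killed, markovFdd, hset]
    rw [← lintegral_const_mul' _ _ (hh hx).2.ne, ← lintegral_indicator hm]
    refine lintegral_congr fun ω => ?_
    by_cases hi : Z.X s ω ∈ inner S
    · by_cases hiB : Z.X s ω ∈ B
      -- The density ratios telescope: multiplying by h at the starting point moves the factor h to
      -- the next position, where the induction hypothesis absorbs it.
      · simp only [indicator, mem_preimage, hi, hiB, if_true, mem_inter_iff, and_self]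
        rw [← ih hl' hi, ← mul_assoc, ENNReal.mul_div_cancel (hh hx).1.ne' (hh hx).2.ne]
      · simp [indicator, hi, hiB]
    · simp [indicator, hi]

theorem lintegral_markovFdd_X_zero (G : Set (State S)) (f : State S → ℝ≥0∞)
    (l : List (ℝ≥0 × Set (State S))) (x : State S) :
    ∫⁻ ω, Z.markovFdd G f l (Z.X 0 ω) ∂Z.P x = Z.markovFdd G f l x := by
  simpa using Z.setLIntegral_X_zero x univ MeasurableSet.univ (Z.markovFdd G f l)

theorem dyadicStays_eq_cylinder (C : Set (State S)) (u t : ℝ≥0) (m : ℕ) :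
    Z.dyadicStays C u t m =
      cylinder Z.X (fun t ω => Z.X t ω ∈ (univ : Set (State S))) (dyadicVisits C t m) u := by
  ext ω
  simp [mem_cylinder_dyadicVisits, dyadicStays]

theorem setLIntegral_dyadicStays_eq_markovFdd {C : Set (State S)} (hC : MeasurableSet C)
    {f : State S → ℝ≥0∞} (hf : Measurable f) (t : ℝ≥0) (m : ℕ) (z : State S) :
    ∫⁻ ω in Z.dyadicStays C 0 t m, f (Z.X t ω) ∂Z.P z =
      Z.markovFdd univ f (dyadicVisits C t m) z := by
  have := setLIntegral_cylinder (Z := Z) MeasurableSet.univ hf (dyadicVisits C t m)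
    (fun p hp => measurableSet_of_mem_dyadicVisits hC hp) 0 (A := univ) MeasurableSet.univ z
  rwa [Measure.restrict_univ, lintegral_markovFdd_X_zero, univ_inter, sum_dyadicVisits,
    zero_add, ← dyadicStays_eq_cylinder] at this

theorem measurable_setLIntegral_dyadicStays {C : Set (State S)} (hC : MeasurableSet C)
    {f : State S → ℝ≥0∞} (hf : Measurable f) (t : ℝ≥0) (m : ℕ) :
    Measurable fun z => ∫⁻ ω in Z.dyadicStays C 0 t m, f (Z.X t ω) ∂Z.P z := by
  simp_rw [setLIntegral_dyadicStays_eq_markovFdd hC hf]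
  exact measurable_markovFdd MeasurableSet.univ hf _
    fun p hp => measurableSet_of_mem_dyadicVisits hC hp

theorem setLIntegral_dyadicStays {C : Set (State S)} (hC : MeasurableSet C) {f : State S → ℝ≥0∞}
    (hf : Measurable f) (u t : ℝ≥0) (m : ℕ) {A : Set Ω} (hA : MeasurableSet[Z.ℱ u] A)
    (x : State S) :
    ∫⁻ ω in A ∩ Z.dyadicStays C u t m, f (Z.X (u + t) ω) ∂Z.P x =
      ∫⁻ ω in A, ∫⁻ ω' in Z.dyadicStays C 0 t m, f (Z.X t ω') ∂Z.P (Z.X u ω) ∂Z.P x := by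
  have := setLIntegral_cylinder (Z := Z) MeasurableSet.univ hf (dyadicVisits C t m)
      (fun p hp => measurableSet_of_mem_dyadicVisits hC hp) u hA x
  rw [sum_dyadicVisits, ← dyadicStays_eq_cylinder] at this
  simp_rw [setLIntegral_dyadicStays_eq_markovFdd hC hf]
  exact this

/-! ### The supermartingale inequality and quasi-left-continuity. -/

theorem stays_subset_lt_exitTime {C D : Set (State S)} (hD : IsOpen D) (hCD : C ⊆ D) (t : ℝ≥0) :
    Z.stays C t ⊆ {ω | (t : ℝ≥0∞) < exitTime Z.X D ω} := fun ω hω =>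
  lt_exitTime_of_isOpen hD (Z.right_continuous ω t) fun s hs => hCD (hω s hs)

theorem stays_mono {C C' : Set (State S)} (h : C ⊆ C') (t : ℝ≥0) : Z.stays C t ⊆ Z.stays C' t :=
  fun _ hω s hs => h (hω s hs)

/-- A function that is excessive on `D` gives a supermartingale for the process killed when it
leaves a closed subset of `D`. -/
theorem ExcessiveOn.setLIntegral_stays_le {D : Set (State S)} {H : State S → ℝ≥0∞}
    (hH : Z.ExcessiveOn D H) (hD : IsOpen D) {C : Set (State S)} (hC : IsClosed C) (hCD : C ⊆ D)
    {s : ℝ≥0} (t : ℝ≥0) {A : Set Ω} (hA : MeasurableSet[Z.ℱ s] A) (x : State S) :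
    ∫⁻ ω in A ∩ Z.stays C (s + t), H (Z.X (s + t) ω) ∂Z.P x ≤
      ∫⁻ ω in A ∩ Z.stays C s, H (Z.X s ω) ∂Z.P x := by
  have hA' : MeasurableSet[Z.ℱ s] (A ∩ Z.stays C s) := hA.inter (Z.measurableSet_stays hC s)
  have hsup : ∀ a : ℝ≥0∞, a = ⨆ N : ℕ, min a N := fun a => by
    rw [← inf_iSup_eq]; simp [ENNReal.iSup_natCast]
  have hmeas : ∀ N : ℕ, Measurable fun z => min (H z) N := fun N => hH.measurable.min measurable_const
  have key : ∀ N : ℕ, ∫⁻ ω in A ∩ Z.stays C (s + t), min (H (Z.X (s + t) ω)) N ∂Z.P x ≤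
      ∫⁻ ω in A ∩ Z.stays C s, H (Z.X s ω) ∂Z.P x := by
    intro N
    -- The dyadic events depend on finitely many times, so the Markov property at s applies to them
    -- and `g m` is measurable. The truncation at N permits the decreasing limit in m.
    set g : ℕ → State S → ℝ≥0∞ := fun m z =>
      ∫⁻ ω in Z.dyadicStays C 0 t m, min (H (Z.X t ω)) N ∂Z.P z with hg
    have hfin : ∀ z, ∫⁻ ω, min (H (Z.X t ω)) N ∂Z.P z ≤ N := fun z => by
      refine (lintegral_mono fun ω => min_le_right _ _).trans ?_
      simp
    have hgN : ∀ m z, g m z ≤ N := fun m z => (setLIntegral_le_lintegral _ _).trans (hfin z)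
    have hmd : ∀ m, MeasurableSet (Z.dyadicStays C 0 t m) := fun m =>
      Z.ℱ.le _ _ (Z.measurableSet_dyadicStays hC.measurableSet 0 t m)
    have hgm : ∀ m, Measurable (g m) :=
      measurable_setLIntegral_dyadicStays hC.measurableSet (hmeas N) t
    have hganti : ∀ z, Antitone fun m => g m z := fun z m m' h =>
      lintegral_mono_set (Z.antitone_dyadicStays C 0 t h)
    have hgH : ∀ z ∈ C, ⨅ m, g m z ≤ H z := by
      intro z hz
      rw [iInf_setLIntegral_of_antitone (Z.antitone_dyadicStays C 0 t) hmd
        ((hfin z).trans_lt (ENNReal.natCast_lt_top N)).ne, Z.iInter_dyadicStays hC]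
      simp only [zero_add]
      refine le_trans ?_ (hH.le z (hCD hz) t)
      exact (lintegral_mono_set (stays_subset_lt_exitTime hD hCD t)).trans
        (lintegral_mono fun ω => min_le_left _ _)
    have h1 : ∀ m, ∫⁻ ω in A ∩ Z.stays C (s + t), min (H (Z.X (s + t) ω)) N ∂Z.P x ≤
        ∫⁻ ω in A ∩ Z.stays C s, g m (Z.X s ω) ∂Z.P x := by
      intro m
      rw [hg, ← setLIntegral_dyadicStays hC.measurableSet (hmeas N) s t m hA' x]
      refine lintegral_mono_set fun ω hω => ⟨⟨hω.1, fun r hr => hω.2 r (hr.trans le_self_add)⟩,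
        fun j hj => hω.2 _ ?_⟩
      gcongr
      exact dyadic_le hj
    calc _ ≤ ⨅ m, ∫⁻ ω in A ∩ Z.stays C s, g m (Z.X s ω) ∂Z.P x := le_iInf h1
      _ = ∫⁻ ω in A ∩ Z.stays C s, ⨅ m, g m (Z.X s ω) ∂Z.P x := by
        refine (lintegral_iInf (fun m => (hgm m).comp (Z.measurable_X s))
          (fun m m' h ω => hganti _ h) ?_).symm
        refine ne_top_of_le_ne_top (ENNReal.natCast_ne_top N) ?_
        refine (setLIntegral_le_lintegral _ _).trans
          ((lintegral_mono fun ω => hgN 0 _).trans ?_)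
        simp
      _ ≤ _ := setLIntegral_mono' (Z.ℱ.le _ _ hA') fun ω hω => hgH _ (hω.2 s le_rfl)
  calc ∫⁻ ω in A ∩ Z.stays C (s + t), H (Z.X (s + t) ω) ∂Z.P x
      = ∫⁻ ω in A ∩ Z.stays C (s + t), ⨆ N : ℕ, min (H (Z.X (s + t) ω)) N ∂Z.P x := by
        simp_rw [← hsup]
    _ = ⨆ N : ℕ, ∫⁻ ω in A ∩ Z.stays C (s + t), min (H (Z.X (s + t) ω)) N ∂Z.P x :=
        lintegral_iSup (fun N => (hmeas N).comp (Z.measurable_X _)) fun N N' h ω => by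
          dsimp only; gcongr
    _ ≤ _ := iSup_le key

/-- A strict exit before i is visible at a countable dense set of positive times because the
complement of C is open. Right-continuity of the filtration does the rest. -/
theorem isStoppingTime_exitTime {C : Set (State S)} (hC : IsClosed C) :
    IsStoppingTime Z.ℱ (exitTime Z.X C) := by
  have := Z.rightContinuous_filtration
  refine isStoppingTime_of_measurableSet_lt_of_isRightContinuous fun i => ?_
  have hset : {ω | exitTime Z.X C ω < (i : ℝ≥0∞)} = ⋃ k : ℕ,
      ⋃ (_ : TopologicalSpace.denseSeq ℝ≥0 k < i ∧ 0 < TopologicalSpace.denseSeq ℝ≥0 k),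
        Z.X (TopologicalSpace.denseSeq ℝ≥0 k) ⁻¹' Cᶜ := by
    ext ω
    simp only [mem_ofPred_eq, exitTime_lt_iff, mem_iUnion, exists_prop, mem_preimage,
      mem_compl_iff, ENNReal.coe_lt_coe]
    constructor
    · rintro ⟨s, ⟨h0, hs⟩, hsi⟩
      obtain ⟨u, hu, hu'⟩ := (mem_nhdsGE_iff_exists_Ico_subset' hsi).1
        ((Z.right_continuous ω s).eventually (hC.isOpen_compl.mem_nhds hs))
      obtain ⟨_, ⟨k, rfl⟩, hk1, hk2⟩ :=
        (TopologicalSpace.denseRange_denseSeq ℝ≥0).exists_between (lt_min hu hsi)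
      exact ⟨k, ⟨hk2.trans_le (min_le_right _ _), h0.trans hk1⟩,
        hu' ⟨hk1.le, hk2.trans_le (min_le_left _ _)⟩⟩
    · rintro ⟨k, ⟨h1, h2⟩, h3⟩
      exact ⟨_, ⟨h2, h3⟩, h1⟩
  change MeasurableSet[Z.ℱ i] {ω | exitTime Z.X C ω < (i : ℝ≥0∞)}
  rw [hset]
  refine MeasurableSet.iUnion fun k => MeasurableSet.iUnion fun hk => ?_
  exact Z.ℱ.mono hk.1.le _ (Z.adapted _ hC.isOpen_compl.measurableSet)

/-- By quasi-left-continuity, a path that does not leave an open subset of the interior up to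
time `t` stays in one of the sets of any exhaustion of it. -/
theorem ae_exists_stays {U : Set (State S)} (hU : U ⊆ inner S) {C : ℕ → Set (State S)}
    (hC : ∀ k, IsClosed (C k)) (hCi : ∀ k, C k ⊆ interior (C (k + 1))) (hCU : ⋃ k, C k = U)
    {x : State S} (hx : x ∈ U) (t : ℝ≥0) :
    ∀ᵐ ω ∂Z.P x, (t : ℝ≥0∞) < exitTime Z.X U ω → ∃ k, ω ∈ Z.stays (C k) t := by
  have hmono : Monotone C := monotone_nat_of_le_succ fun k => (hCi k).trans interior_subset
  filter_upwards [Z.start x, Z.quasi_left_continuous (fun k => exitTime Z.X (C k))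
    (fun k => isStoppingTime_exitTime (hC k)) (fun ω k k' h => exitTime_mono (hmono h)) x]
    with ω h0 hql ht
  -- If the path stays in no C k, all exit times are at most t. Their supremum lies before the
  -- lifetime, so the exit positions converge to a point of U. They then lie in the interior of C k
  -- for large k, which is impossible at an exit time.
  by_contra! hns
  have hT : ∀ k, exitTime Z.X (C k) ω ≤ t := fun k => by
    by_contra! hk
    exact hns k fun s hs => mem_of_lt_exitTime_of_isClosed (hC k) (Z.right_continuous ω 0) hk hs
  have hsup : ⨆ k, exitTime Z.X (C k) ω ≤ t := iSup_le hT
  have hlim := hql (hsup.trans_lt (ht.trans_le (exitTime_mono hU)))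
  set r := (⨆ k, exitTime Z.X (C k) ω).toNNReal with hr
  have hrt : r ≤ t := by
    have := ENNReal.toNNReal_mono ENNReal.coe_ne_top hsup
    simpa using this
  have hrU : Z.X r ω ∈ U := by
    rcases (zero_le (a := r)).eq_or_lt with h | h
    · rw [← h, h0]; exact hx
    · exact mem_of_lt_exitTime ht h hrt
  rw [← hCU] at hrU
  obtain ⟨j, hj⟩ := mem_iUnion.1 hrU
  obtain ⟨k, hk, hkj⟩ := ((hlim.eventually
    (isOpen_interior.mem_nhds (hCi j hj))).and (eventually_ge_atTop (j + 1))).exists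
  exact notMem_interior_of_exitTime_eq (Z.right_continuous ω _)
    (ENNReal.coe_toNNReal ((hT k).trans_lt ENNReal.coe_lt_top).ne).symm
    (interior_mono (hmono hkj) hk)

end StandardProcess

end Inversion

end

noncomputable section

namespace Inversion

variable {n : ℕ} {S : Set (EuclideanSpace ℝ (Fin n))} {Ω : Type*}

namespace StandardProcess

variable [MeasurableSpace Ω] {Z : StandardProcess S Ω}

/-! ### Optional stopping -/

/-- Optional stopping for stopping times with values in an increasing sequence. -/
theorem ExcessiveOn.sum_setLIntegral_le {D : Set (State S)} {H : State S → ℝ≥0∞}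
    (hH : Z.ExcessiveOn D H) (hD : IsOpen D) {C : Set (State S)} (hC : IsClosed C) (hCD : C ⊆ D)
    {T : Ω → ℝ≥0∞} (hT : ∀ s : ℝ≥0, MeasurableSet[Z.ℱ s] {ω | T ω < s})
    {a : ℕ → ℝ≥0} (ha : Monotone a) (ha0 : a 0 = 0) (y : State S) (M : ℕ) :
    ∑ k ∈ Finset.range M, ∫⁻ ω in {ω | a k ≤ T ω ∧ T ω < a (k + 1)} ∩ Z.stays C (a (k + 1)),
        H (Z.X (a (k + 1)) ω) ∂Z.P y +
      ∫⁻ ω in {ω | a M ≤ T ω} ∩ Z.stays C (a M), H (Z.X (a M) ω) ∂Z.P y ≤ H y := by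
  have hge : ∀ s : ℝ≥0, MeasurableSet[Z.ℱ s] {ω | (s : ℝ≥0∞) ≤ T ω} := fun s => by
    convert (hT s).compl using 1
    ext ω
    simp
  induction M with
  | zero =>
    have h0 : {ω | ((a 0 : ℝ≥0) : ℝ≥0∞) ≤ T ω} ∩ Z.stays C (a 0) = {ω | Z.X 0 ω ∈ C} := by
      ext ω
      simp [ha0, stays]
    rw [h0, ha0, Z.setLIntegral_X_zero y C hC.measurableSet]
    simpa using indicator_le_self C H y
  | succ M ih =>
    refine le_trans ?_ ih
    rw [Finset.sum_range_succ, add_assoc]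
    gcongr
    -- Paths not stopped before a M are run to a (M + 1) at no gain in expectation, then split
    -- according to whether T occurs in between.
    have h1 := hH.setLIntegral_stays_le hD hC hCD (a (M + 1) - a M) (hge (a M)) y
    rw [add_tsub_cancel_of_le (ha M.le_succ)] at h1
    refine le_trans (le_of_eq ?_) h1
    have hst := Z.ℱ.le _ _ (Z.measurableSet_stays hC (a (M + 1)))
    rw [← lintegral_union ((Z.ℱ.le _ _ (hge (a (M + 1)))).inter hst)]
    · congr 2
      ext ω
      have : ((a M : ℝ≥0) : ℝ≥0∞) ≤ a (M + 1) := ENNReal.coe_le_coe.2 (ha M.le_succ)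
      simp only [mem_union, mem_inter_iff, mem_ofPred_eq, ← or_and_right]
      refine and_congr_left fun _ => ⟨?_, fun h => ?_⟩
      · rintro (h | h)
        exacts [h.1, this.trans h]
      · rcases lt_or_ge (T ω) (a (M + 1)) with h' | h'
        exacts [Or.inl ⟨h, h'⟩, Or.inr h']
    · rw [disjoint_left]
      rintro ω ⟨h, -⟩ ⟨h', -⟩
      exact absurd h.2 (not_lt.2 h')

/-- Optional stopping for excessive functions: the process is stopped at `T`, on the event that it
has stayed in `C` until then. -/
theorem ExcessiveOn.setLIntegral_stopped_le {D : Set (State S)} {H : State S → ℝ≥0∞}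
    (hH : Z.ExcessiveOn D H) (hD : IsOpen D) {C C' : Set (State S)} (hC : IsClosed C')
    (hCC' : C ⊆ interior C') (hCD : C' ⊆ D) (hcont : ContinuousOn H (interior C'))
    {T : Ω → ℝ≥0∞} (hT : ∀ s : ℝ≥0, MeasurableSet[Z.ℱ s] {ω | T ω < s}) (y : State S) :
    ∫⁻ ω in {ω | T ω < ∞ ∧ ∀ s : ℝ≥0, s ≤ T ω → Z.X s ω ∈ C}, H (Z.X (T ω).toNNReal ω) ∂Z.P y ≤
      H y := by
  set a : ℕ → ℕ → ℝ≥0 := fun N k => (k : ℝ≥0) / (N + 1 : ℕ) with ha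
  have hmono : ∀ N, Monotone (a N) := fun N k l h => by
    simp only [ha]; gcongr
  have ha0 : ∀ N, a N 0 = 0 := fun N => by simp [ha]
  set B : ℕ → ℕ → Set Ω := fun N k =>
    {ω | a N k ≤ T ω ∧ T ω < a N (k + 1)} ∩ Z.stays C' (a N (k + 1)) with hB
  have hBm : ∀ N k, MeasurableSet (B N k) := fun N k => by
    have h1 : {ω | ((a N k : ℝ≥0) : ℝ≥0∞) ≤ T ω} = {ω | T ω < a N k}ᶜ := by ext ω; simp
    have h2 : MeasurableSet {ω | ((a N k : ℝ≥0) : ℝ≥0∞) ≤ T ω} :=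
      h1 ▸ (Z.ℱ.le _ _ (hT (a N k))).compl
    exact (h2.inter (Z.ℱ.le _ _ (hT _))).inter (Z.ℱ.le _ _ (Z.measurableSet_stays hC _))
  -- F N evaluates H at the first grid point strictly after T, provided the path is still in C'
  -- there. The larger set C' leaves room for this overshoot.
  set F : ℕ → Ω → ℝ≥0∞ := fun N ω =>
    ∑' k, (B N k).indicator (fun ω => H (Z.X (a N (k + 1)) ω)) ω with hF
  have hterm : ∀ N k, Measurable ((B N k).indicator fun ω => H (Z.X (a N (k + 1)) ω)) :=
    fun N k => (hH.measurable.comp (Z.measurable_X _)).indicator (hBm N k)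
  have hFm : ∀ N, Measurable (F N) := fun N => Measurable.tsum (hterm N)
  have hFle : ∀ N, ∫⁻ ω, F N ω ∂Z.P y ≤ H y := fun N => by
    rw [hF, lintegral_tsum fun k => (hterm N k).aemeasurable]
    refine ENNReal.tsum_le_of_sum_range_le fun M => ?_
    simp_rw [lintegral_indicator (hBm N _)]
    exact le_self_add.trans (hH.sum_setLIntegral_le hD hC hCD hT (hmono N) (ha0 N) y M)
  have hlim : ∀ ω ∈ {ω | T ω < ∞ ∧ ∀ s : ℝ≥0, s ≤ T ω → Z.X s ω ∈ C},
      H (Z.X (T ω).toNNReal ω) ≤ liminf (fun N => F N ω) atTop := by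
    rintro ω ⟨hfin, hst⟩
    obtain ⟨τ, hτ⟩ : ∃ τ : ℝ≥0, (τ : ℝ≥0∞) = T ω := ⟨_, ENNReal.coe_toNNReal hfin.ne⟩
    rw [← hτ] at hst ⊢
    simp only [ENNReal.coe_le_coe] at hst
    rw [ENNReal.toNNReal_coe]
    have hτC : Z.X τ ω ∈ interior C' := hCC' (hst τ le_rfl)
    have hlimτ := NNReal.tendsto_floor_succ_div τ
    have hX := (Z.right_continuous ω τ).tendsto.comp hlimτ
    have hHX : Tendsto (fun N : ℕ => H (Z.X (a N (⌊τ * (N + 1 : ℕ)⌋₊ + 1)) ω)) atTop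
        (𝓝 (H (Z.X τ ω))) :=
      ((hcont.continuousAt (isOpen_interior.mem_nhds hτC)).tendsto).comp hX
    rw [← hHX.liminf_eq]
    refine liminf_le_liminf ?_
    obtain ⟨u, hu, hu'⟩ := (mem_nhdsGE_iff_exists_Ico_subset' (lt_add_one τ)).1
      ((Z.right_continuous ω τ).eventually (isOpen_interior.mem_nhds hτC))
    have hev : ∀ᶠ N : ℕ in atTop, a N (⌊τ * (N + 1 : ℕ)⌋₊ + 1) < u :=
      (tendsto_nhds_of_tendsto_nhdsWithin hlimτ).eventually (gt_mem_nhds hu)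
    filter_upwards [hev] with N hN
    have hmem : ω ∈ B N ⌊τ * (N + 1 : ℕ)⌋₊ := by
      refine ⟨⟨?_, ?_⟩, fun s hs => ?_⟩
      · rw [← hτ, ENNReal.coe_le_coe, div_le_iff₀ (by positivity)]
        exact Nat.floor_le zero_le
      · rw [← hτ, ENNReal.coe_lt_coe, lt_div_iff₀ (by positivity)]
        exact_mod_cast Nat.lt_floor_add_one _
      · rcases le_total s τ with h | h
        · exact interior_subset (hCC' (hst s h))
        · exact interior_subset (hu' ⟨h, hs.trans_lt hN⟩)
    refine le_trans (le_of_eq ?_) (ENNReal.le_tsum ⌊τ * (N + 1 : ℕ)⌋₊)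
    rw [indicator_of_mem hmem]
  calc ∫⁻ ω in {ω | T ω < ∞ ∧ ∀ s : ℝ≥0, s ≤ T ω → Z.X s ω ∈ C}, H (Z.X (T ω).toNNReal ω) ∂Z.P y
      ≤ ∫⁻ ω, liminf (fun N => F N ω) atTop ∂Z.P y :=
        (setLIntegral_mono (Measurable.liminf hFm) hlim).trans (setLIntegral_le_lintegral _ _)
    _ ≤ liminf (fun N => ∫⁻ ω, F N ω ∂Z.P y) atTop := lintegral_liminf_le hFm
    _ ≤ H y := by
        refine (liminf_le_liminf (Eventually.of_forall hFle)).trans ?_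
        simp

/-! ### The time change -/

section clock

variable {v : State S → ℝ} {ω : Ω}

theorem additive_mono : Monotone fun t => Z.additive v t ω := fun s t h =>
  lintegral_mono_set (Ioc_subset_Ioc_right (by exact_mod_cast h))

theorem clock_lt_iff {t : ℝ≥0} {c : ℝ≥0∞} :
    Z.clock v t ω < c ↔ ∃ s : ℝ≥0, (t : ℝ≥0∞) < Z.additive v s ω ∧ (s : ℝ≥0∞) < c := by
  simp only [clock, iInf_lt_iff, exists_prop]

theorem additive_le_of_lt_clock {s t : ℝ≥0} (h : (s : ℝ≥0∞) < Z.clock v t ω) :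
    Z.additive v s ω ≤ t := by
  by_contra! hlt
  exact absurd h (not_lt.2 (iInf₂_le s hlt))

/-- Just after s, continuity bounds v along the path by its value at time s plus 1, so the integrand
has a positive lower bound on a nontrivial interval. -/
theorem additive_lt_additive (hv : ∀ x ∈ inner S, 0 < v x) (hvc : ContinuousOn v (inner S))
    {s s' : ℝ≥0} (hss' : s < s') (hs' : Z.X s' ω ∈ inner S) (hfin : Z.additive v s ω ≠ ∞) :
    Z.additive v s ω < Z.additive v s' ω := by
  have hs : Z.X s ω ∈ inner S := mem_inner_of_le hss'.le hs'
  have hcont : ContinuousWithinAt (fun r => v (Z.X r ω)) (Ici s) s :=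
    ContinuousAt.comp_continuousWithinAt (f := fun r => Z.X r ω)
      (hvc.continuousAt (isOpen_inner.mem_nhds hs)) (Z.right_continuous ω s)
  obtain ⟨u, hu, hu'⟩ := (mem_nhdsGE_iff_exists_Ico_subset' hss').1
    (hcont.eventually (gt_mem_nhds (lt_add_one (v (Z.X s ω)))))
  obtain ⟨w, hsw, hw⟩ := exists_between (lt_min hu hss')
  obtain ⟨hwu, hws'⟩ := lt_min_iff.1 hw
  have hM : 0 < v (Z.X s ω) + 1 := by linarith [hv _ hs]
  set c : ℝ≥0∞ := ENNReal.ofReal (v (Z.X s ω) + 1)⁻¹ with hc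
  have hpos : 0 < ∫⁻ r in Ioc (s : ℝ) w, ENNReal.ofReal (v (Z.X r.toNNReal ω))⁻¹ := by
    have h1 : ∫⁻ r in Ioc (s : ℝ) w, c ≤
        ∫⁻ r in Ioc (s : ℝ) w, ENNReal.ofReal (v (Z.X r.toNNReal ω))⁻¹ := by
      refine setLIntegral_mono' measurableSet_Ioc fun r hr => ?_
      have hr1 : s ≤ r.toNNReal := by
        rw [← Real.toNNReal_coe (r := s)]; exact Real.toNNReal_mono hr.1.le
      have hr2 : r.toNNReal ≤ w := by
        rw [← Real.toNNReal_coe (r := w)]; exact Real.toNNReal_mono hr.2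
      have h2 := hu' ⟨hr1, hr2.trans_lt hwu⟩
      have h3 := hv _ (mem_inner_of_le (hr2.trans hws'.le) hs')
      exact ENNReal.ofReal_le_ofReal (inv_anti₀ h3 (le_of_lt h2))
    refine lt_of_lt_of_le ?_ h1
    rw [setLIntegral_const, Real.volume_Ioc]
    refine ENNReal.mul_pos (ENNReal.ofReal_pos.2 (inv_pos.2 hM)).ne'
      (ENNReal.ofReal_pos.2 (sub_pos.2 (by exact_mod_cast hsw))).ne'
  calc Z.additive v s ω
      < Z.additive v s ω + ∫⁻ r in Ioc (s : ℝ) w, ENNReal.ofReal (v (Z.X r.toNNReal ω))⁻¹ :=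
        ENNReal.lt_add_right hfin hpos.ne'
    _ = Z.additive v w ω := by
        rw [additive, additive, ← lintegral_union measurableSet_Ioc
          (Ioc_disjoint_Ioc_of_le le_rfl), Ioc_union_Ioc_eq_Ioc s.coe_nonneg (NNReal.coe_le_coe.2 hsw.le)]
    _ ≤ Z.additive v s' ω := additive_mono hws'.le

/-- If the time-changed path is in a closed set at all dyadic fractions of `t`, then the path is
in this set until the time `γ_t`. -/
theorem mem_of_le_clock (hv : ∀ x ∈ inner S, 0 < v x) (hvc : ContinuousOn v (inner S)) {t : ℝ≥0}
    (ht : Z.clock v t ω < Z.lifetime ω) {J : Set (State S)} (hJ : IsClosed J)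
    (h : ∀ m j : ℕ, j ≤ 2 ^ m → Z.X (Z.clock v (j * (t / 2 ^ m)) ω).toNNReal ω ∈ J)
    {s : ℝ≥0} (hs : s ≤ Z.clock v t ω) : Z.X s ω ∈ J := by
  rcases hs.eq_or_lt with hs | hs
  · have := h 0 1 (by norm_num)
    simpa [← hs] using this
  by_contra hsJ
  obtain ⟨c, hc⟩ : ∃ c : ℝ≥0, (c : ℝ≥0∞) = Z.clock v t ω := ⟨_, ENNReal.coe_toNNReal ht.ne_top⟩
  rw [← hc] at hs
  have hs : s < c := by exact_mod_cast hs
  -- The path is outside J on [s, u). A dyadic fraction q of t strictly between A_s and A_s', with s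
  -- < s' < u, satisfies s ≤ γ_q ≤ s', contradicting the test at q.
  obtain ⟨u, hu, hu'⟩ := (mem_nhdsGE_iff_exists_Ico_subset' hs).1
    ((Z.right_continuous ω s).eventually (hJ.isOpen_compl.mem_nhds hsJ))
  obtain ⟨s', hss', hs'⟩ := exists_between (lt_min hu hs)
  obtain ⟨hs'u, hs'c⟩ := lt_min_iff.1 hs'
  have hcC : Z.X c ω ∈ inner S := lt_exitTime_inner_iff.1 (hc ▸ ht)
  have hA : Z.additive v s ω ≤ t :=
    additive_le_of_lt_clock (hc ▸ (by exact_mod_cast hs))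
  have hA' : Z.additive v s' ω ≤ t :=
    additive_le_of_lt_clock (hc ▸ (by exact_mod_cast hs'c))
  have hlt := additive_lt_additive hv hvc hss' (mem_inner_of_le hs'c.le hcC)
    (hA.trans_lt ENNReal.coe_lt_top).ne
  obtain ⟨p, hp⟩ : ∃ p : ℝ≥0, (p : ℝ≥0∞) = Z.additive v s ω :=
    ⟨_, ENNReal.coe_toNNReal (hA.trans_lt ENNReal.coe_lt_top).ne⟩
  obtain ⟨p', hp'⟩ : ∃ p : ℝ≥0, (p : ℝ≥0∞) = Z.additive v s' ω :=
    ⟨_, ENNReal.coe_toNNReal (hA'.trans_lt ENNReal.coe_lt_top).ne⟩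
  rw [← hp, ← hp', ENNReal.coe_lt_coe] at hlt
  rw [← hp', ENNReal.coe_le_coe] at hA'
  obtain ⟨m, j, hj, hj1, hj2⟩ := NNReal.exists_dyadic_mul_mem_Ioo hlt hA'
  set q : ℝ≥0 := j * (t / 2 ^ m) with hq
  have hle : Z.clock v q ω ≤ s' := iInf₂_le s' (by rw [← hp']; exact_mod_cast hj2)
  have hge : (s : ℝ≥0∞) ≤ Z.clock v q ω := by
    refine le_iInf₂ fun r hr => ?_
    rw [ENNReal.coe_le_coe]
    by_contra! hrs
    have := hr.trans_le (additive_mono (Z := Z) (v := v) (ω := ω) hrs.le)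
    simp only [← hp, ENNReal.coe_lt_coe] at this
    exact lt_asymm this hj1
  obtain ⟨r, hr⟩ : ∃ r : ℝ≥0, (r : ℝ≥0∞) = Z.clock v q ω :=
    ⟨_, ENNReal.coe_toNNReal (hle.trans_lt ENNReal.coe_lt_top).ne⟩
  have hmem := h m j hj
  rw [← hq, ← hr, ENNReal.toNNReal_coe] at hmem
  rw [← hr, ENNReal.coe_le_coe] at hle hge
  exact hu' ⟨hge, hle.trans_lt hs'u⟩ hmem

end clock

open Classical in
/-- The time `γ_t` on the event `γ_t < ζ`, and `∞` elsewhere. -/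
def aliveClock (Z : StandardProcess S Ω) (v : State S → ℝ) (t : ℝ≥0) (ω : Ω) : ℝ≥0∞ :=
  if Z.clock v t ω < Z.lifetime ω then Z.clock v t ω else ∞

theorem aliveClock_lt_top_iff {v : State S → ℝ} {t : ℝ≥0} {ω : Ω} :
    Z.aliveClock v t ω < ∞ ↔ Z.clock v t ω < Z.lifetime ω := by
  unfold aliveClock
  split_ifs with h
  · simp [h, h.ne_top, lt_top_iff_ne_top]
  · simp [h]

theorem aliveClock_eq {v : State S → ℝ} {t : ℝ≥0} {ω : Ω}
    (h : Z.clock v t ω < Z.lifetime ω) : Z.aliveClock v t ω = Z.clock v t ω := if_pos h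

/-- Only times at which the path is in E° enter, so the values of v outside E°, where nothing is
assumed, do not affect measurability. -/
theorem aliveClock_lt_iff {v : State S → ℝ} {t s : ℝ≥0} {ω : Ω} :
    Z.aliveClock v t ω < s ↔ ∃ k : ℕ, TopologicalSpace.denseSeq ℝ≥0 k < s ∧
      Z.X (TopologicalSpace.denseSeq ℝ≥0 k) ω ∈ inner S ∧
      (t : ℝ≥0∞) < Z.additive v (TopologicalSpace.denseSeq ℝ≥0 k) ω := by
  constructor
  · intro h
    have hal := aliveClock_lt_top_iff.1 (h.trans ENNReal.coe_lt_top)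
    rw [aliveClock_eq hal] at h
    obtain ⟨r, hr, hrs⟩ := clock_lt_iff.1 (lt_min h hal)
    obtain ⟨u, hru, hu⟩ := ENNReal.lt_iff_exists_nnreal_btwn.1 hrs
    obtain ⟨_, ⟨k, rfl⟩, hk1, hk2⟩ :=
      (TopologicalSpace.denseRange_denseSeq ℝ≥0).exists_between (ENNReal.coe_lt_coe.1 hru)
    have hus : u < s := by exact_mod_cast hu.trans_le (min_le_left _ _)
    exact ⟨k, hk2.trans hus, mem_inner_of_le hk2.le
      (lt_exitTime_inner_iff.1 (hu.trans_le (min_le_right _ _))),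
      hr.trans_le (additive_mono hk1.le)⟩
  · rintro ⟨k, hks, hkX, hk⟩
    have h1 : Z.clock v t ω ≤ (TopologicalSpace.denseSeq ℝ≥0 k : ℝ≥0) := iInf₂_le (TopologicalSpace.denseSeq ℝ≥0 k) hk
    have h2 : Z.clock v t ω < Z.lifetime ω := h1.trans_lt (lt_exitTime_inner_iff.2 hkX)
    rw [aliveClock_eq h2]
    exact h1.trans_lt (by exact_mod_cast hks)

theorem measurableSet_lt_additive [LocallyCompactSpace S] {v : State S → ℝ}
    (hvc : ContinuousOn v (inner S)) (t s : ℝ≥0) :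
    MeasurableSet[Z.ℱ s] {ω | Z.X s ω ∈ inner S ∧ (t : ℝ≥0∞) < Z.additive v s ω} := by
  have := metrizableSpace_state (S := S)
  set g : State S → ℝ≥0∞ := (inner S).indicator fun x => ENNReal.ofReal (v x)⁻¹ with hg
  have hgm : Measurable g := by
    have h1 : Measurable ((inner S).indicator v) := by
      classical
      exact hvc.measurable_piecewise continuousOn_const isOpen_inner.measurableSet
    have h2 : g = (inner S).indicator fun x => ENNReal.ofReal ((inner S).indicator v x)⁻¹ := by
      ext x
      by_cases hx : x ∈ inner S <;> simp [hg, hx]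
    rw [h2]
    exact h1.inv.ennreal_ofReal.indicator isOpen_inner.measurableSet
  -- Freezing the path at time s makes it a right-continuous process that is measurable for the
  -- σ-field at s.
  have hmeas : Measurable[Z.ℱ s]
      fun ω => ∫⁻ r in Ioc (0 : ℝ) s, g (Z.X (min r.toNNReal s) ω) := by
    refine @measurable_setLIntegral_of_right_continuous Ω (State S) (Z.ℱ s) _ _ _ _
      (fun r ω => Z.X (min r s) ω)
      (fun r => (Z.adapted _).mono (Z.ℱ.mono (min_le_right r s)) le_rfl) (fun ω r => ?_) g hgm _
    exact (Z.right_continuous ω (min r s)).comp (f := fun q => min q s) (t := Ici (min r s))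
      (Continuous.continuousWithinAt (by fun_prop)) fun q hq => min_le_min_right s hq
  have hset : {ω | Z.X s ω ∈ inner S ∧ (t : ℝ≥0∞) < Z.additive v s ω} = Z.X s ⁻¹' inner S ∩
      {ω | (t : ℝ≥0∞) < ∫⁻ r in Ioc (0 : ℝ) s, g (Z.X (min r.toNNReal s) ω)} := by
    ext ω
    refine and_congr_right fun hω => ?_
    have : Z.additive v s ω = ∫⁻ r in Ioc (0 : ℝ) s, g (Z.X (min r.toNNReal s) ω) := by
      refine setLIntegral_congr_fun measurableSet_Ioc fun r hr => ?_
      have hrs : r.toNNReal ≤ s := by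
        rw [← Real.toNNReal_coe (r := s)]; exact Real.toNNReal_mono hr.2
      simp only [min_eq_left hrs, hg]
      rw [indicator_of_mem (mem_inner_of_le hrs hω)]
    rw [mem_ofPred_eq, this]
  rw [hset]
  exact (Z.adapted s isOpen_inner.measurableSet).inter (measurableSet_lt measurable_const hmeas)

theorem measurableSet_aliveClock_lt [LocallyCompactSpace S] {v : State S → ℝ}
    (hvc : ContinuousOn v (inner S)) (t s : ℝ≥0) :
    MeasurableSet[Z.ℱ s] {ω | Z.aliveClock v t ω < s} := by
  have : {ω | Z.aliveClock v t ω < s} = ⋃ k : ℕ, ⋃ (_ : TopologicalSpace.denseSeq ℝ≥0 k < s),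
      {ω | Z.X (TopologicalSpace.denseSeq ℝ≥0 k) ω ∈ inner S ∧
        (t : ℝ≥0∞) < Z.additive v (TopologicalSpace.denseSeq ℝ≥0 k) ω} := by
    ext ω
    simp only [mem_ofPred_eq, aliveClock_lt_iff, mem_iUnion, exists_prop]
  rw [this]
  exact MeasurableSet.iUnion fun k => MeasurableSet.iUnion fun hk =>
    Z.ℱ.mono hk.le _ (measurableSet_lt_additive hvc t _)

theorem measurable_aliveClock [LocallyCompactSpace S] {v : State S → ℝ}
    (hvc : ContinuousOn v (inner S)) (t : ℝ≥0) : Measurable (Z.aliveClock v t) := by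
  have hfin : ∀ s : ℝ≥0, MeasurableSet {ω | Z.aliveClock v t ω < s} := fun s =>
    Z.ℱ.le _ _ (measurableSet_aliveClock_lt hvc t s)
  refine measurable_of_Iio fun a => ?_
  induction a with
  | coe a => exact hfin a
  | top =>
    have : Z.aliveClock v t ⁻¹' Iio ∞ = ⋃ k : ℕ, {ω | Z.aliveClock v t ω < (k : ℝ≥0)} := by
      ext ω
      simp only [mem_preimage, mem_Iio, mem_iUnion, mem_ofPred_eq]
      refine ⟨fun h => ?_, fun ⟨k, hk⟩ => hk.trans ENNReal.coe_lt_top⟩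
      obtain ⟨k, hk⟩ := ENNReal.exists_nat_gt h.ne
      exact ⟨k, by exact_mod_cast hk⟩
    rw [this]
    exact MeasurableSet.iUnion fun k => hfin k

theorem measurable_X_aliveClock [LocallyCompactSpace S] {v : State S → ℝ}
    (hvc : ContinuousOn v (inner S)) (t : ℝ≥0) :
    Measurable fun ω => Z.X (Z.aliveClock v t ω).toNNReal ω := by
  have := metrizableSpace_state (S := S)
  exact (measurable_uncurry_of_right_continuous Z.measurable_X Z.right_continuous).comp
    ((measurable_aliveClock hvc t).ennreal_toNNReal.prodMk measurable_id)

end StandardProcess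

end Inversion

end

noncomputable section

namespace Inversion

variable {n : ℕ} {S : Set (EuclideanSpace ℝ (Fin n))} {Ω : Type*}

theorem lt_exitTime_inter {α : Type*} {X : ℝ≥0 → Ω → α} {A B : Set α} {ω : Ω} {c : ℝ≥0∞}
    (hA : c < exitTime X A ω) (hB : c < exitTime X B ω) : c < exitTime X (A ∩ B) ω := by
  refine (lt_min hA hB).trans_le (le_iInf₂ fun s hs => ?_)
  rcases not_and_or.1 hs.2 with h | h
  · exact (min_le_left _ _).trans (iInf₂_le s ⟨hs.1, h⟩)
  · exact (min_le_right _ _).trans (iInf₂_le s ⟨hs.1, h⟩)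

namespace StandardProcess

variable [MeasurableSpace Ω] {Z : StandardProcess S Ω}

/-- The event that the time-changed process `I (X_γ)` is alive and in `C` at the dyadic fractions
of `t`. -/
def changedStays (Z : StandardProcess S Ω) (I : State S → State S) (v : State S → ℝ)
    (C : Set (State S)) (t : ℝ≥0) (m : ℕ) : Set Ω :=
  cylinder (fun t ω => I (Z.X (Z.clock v t ω).toNNReal ω))
    (fun t ω => Z.clock v t ω < Z.lifetime ω) (dyadicVisits C t m) 0

/-! ### Dyadic confinement of the time-changed process. -/

section changedStays

variable {I : State S → State S} {v : State S → ℝ} {C : Set (State S)} {t : ℝ≥0} {m : ℕ}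

theorem mem_changedStays {ω : Ω} : ω ∈ Z.changedStays I v C t m ↔ ∀ j : ℕ, j ≤ 2 ^ m →
    Z.clock v (j * (t / 2 ^ m)) ω < Z.lifetime ω ∧
      I (Z.X (Z.clock v (j * (t / 2 ^ m)) ω).toNNReal ω) ∈ C := by
  simp [changedStays, mem_cylinder_dyadicVisits]

theorem antitone_changedStays : Antitone (Z.changedStays I v C t) := by
  refine antitone_nat_of_succ_le fun m ω hω => ?_
  rw [mem_changedStays] at hω ⊢
  intro j hj
  have := hω (2 * j) (by rw [pow_succ]; omega)
  rwa [dyadic_succ] at this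

theorem clock_lt_of_mem_changedStays {ω : Ω} (h : ω ∈ Z.changedStays I v C t m) :
    Z.clock v t ω < Z.lifetime ω := by
  have := (mem_changedStays.1 h (2 ^ m) le_rfl).1
  have ht : ((2 ^ m : ℕ) : ℝ≥0) * (t / 2 ^ m) = t := by push_cast; field_simp
  rwa [ht] at this

theorem measurableSet_changedStays [LocallyCompactSpace S] (hvc : ContinuousOn v (inner S))
    (hI : Measurable I) (hC : MeasurableSet C) : MeasurableSet (Z.changedStays I v C t m) := by
  have : Z.changedStays I v C t m = ⋂ j : ℕ, ⋂ (_ : j ≤ 2 ^ m),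
      {ω | Z.aliveClock v (j * (t / 2 ^ m)) ω < ∞} ∩
        (fun ω => I (Z.X (Z.aliveClock v (j * (t / 2 ^ m)) ω).toNNReal ω)) ⁻¹' C := by
    ext ω
    simp only [mem_changedStays, mem_iInter, mem_inter_iff, mem_ofPred_eq, aliveClock_lt_top_iff,
      mem_preimage]
    refine forall₂_congr fun j _ => and_congr_right fun h => ?_
    rw [aliveClock_eq h]
  rw [this]
  exact MeasurableSet.iInter fun j => MeasurableSet.iInter fun _ =>
    (measurableSet_lt (measurable_aliveClock hvc _) measurable_const).inter
      ((hI.comp (measurable_X_aliveClock hvc _)) hC)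

end changedStays

/-! ### Consequences of the inversion property. -/

section HasIP

variable {I : State S → State S} {h : State S → ℝ≥0∞} {v : State S → ℝ}

/-- If I(x) were on the boundary, the time-changed process from I(x) would be dead at time 0, while
the Doob transform from x is alive there with probability one. -/
theorem HasIP.map_mem_inner (hIP : Z.HasIP I h v) {x : State S} (hx : x ∈ inner S) :
    I x ∈ inner S := by
  by_contra hIx
  have hlaw := hIP.law (I x) [(0, univ)] (by simp)
  rw [hIP.involutive x] at hlaw
  have h0 : Z.P (I x) (cylinder (fun t ω => I (Z.X (Z.clock v t ω).toNNReal ω))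
      (fun t ω => Z.clock v t ω < Z.lifetime ω) [(0, univ)] 0) = 0 := by
    refine measure_mono_null (t := {ω | ¬ Z.X 0 ω = I x}) ?_ (Z.start (I x))
    rintro ω ⟨⟨hω, -⟩, -⟩ hX
    have h1 : ((0 : ℝ≥0) : ℝ≥0∞) < exitTime Z.X (inner S) ω :=
      lt_of_le_of_lt (by simp) hω
    exact hIx (hX ▸ lt_exitTime_inner_iff.1 h1)
  have h1 := mul_semigroupFdd_doob (Z := Z) hIP.inner_subset [(0, univ)] (by simp) hx
  rw [← hlaw, h0, mul_zero] at h1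
  simp only [markovFdd, inter_univ] at h1
  have h2 := Z.setLIntegral_X_zero x univ MeasurableSet.univ ((inner S).indicator h)
  simp only [mem_univ, ofPred_true, Measure.restrict_univ, indicator_univ] at h2
  exact (hIP.inner_subset hx).1.ne (h1.trans (h2.trans (indicator_of_mem hx h)))

/-- The inversion property, integrated against functions of the state at time `t`. -/
theorem HasIP.setLIntegral_dyadicStays [LocallyCompactSpace S] (hIP : Z.HasIP I h v) {x : State S}
    (hx : x ∈ inner S) {C : Set (State S)} (hC : MeasurableSet C) (hCi : C ⊆ inner S) (t : ℝ≥0)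
    (m : ℕ) {f : State S → ℝ≥0∞} (hf : Measurable f) :
    ∫⁻ ω in Z.dyadicStays C 0 t m, h (Z.X t ω) * f (Z.X t ω) ∂Z.P x =
      h x * ∫⁻ ω in Z.changedStays I v C t m, f (I (Z.X (Z.aliveClock v t ω).toNNReal ω))
        ∂Z.P (I x) := by
  have hds : MeasurableSet (Z.dyadicStays C 0 t m) :=
    Z.ℱ.le _ _ (Z.measurableSet_dyadicStays hC 0 t m)
  have hhm : Measurable fun ω => h (Z.X t ω) := hIP.excessive.measurable.comp (Z.measurable_X t)
  have hYm : Measurable fun ω => I (Z.X (Z.aliveClock v t ω).toNNReal ω) :=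
    hIP.measurable.comp (measurable_X_aliveClock hIP.v_continuous t)
  have key : (((Z.P x).restrict (Z.dyadicStays C 0 t m)).withDensity
      fun ω => h (Z.X t ω)).map (Z.X t) = h x • ((Z.P (I x)).restrict
        (Z.changedStays I v C t m)).map fun ω => I (Z.X (Z.aliveClock v t ω).toNNReal ω) := by
    ext B hB
    -- The appended zero increment tests the position at time t once more, against an arbitrary B,
    -- and so yields an identity of measures.
    have hl : ∀ p ∈ dyadicVisits C t m ++ [(0, B)], MeasurableSet p.2 := fun p hp => by
      rcases List.mem_append.1 hp with hp | hp
      · exact measurableSet_of_mem_dyadicVisits hC hp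
      · rw [List.mem_singleton.1 hp]; exact hB
    have h1 := setLIntegral_cylinder (Z := Z) isOpen_inner.measurableSet hIP.excessive.measurable
      _ hl 0 (A := univ) MeasurableSet.univ x
    rw [Measure.restrict_univ, lintegral_markovFdd_X_zero,
      ← mul_semigroupFdd_doob hIP.inner_subset _ hl hx] at h1
    have h2 := hIP.law (I x) _ hl
    rw [hIP.involutive x] at h2
    rw [← h2, univ_inter, cylinder_append, cylinder_append, sum_dyadicVisits] at h1
    have hsum : ((dyadicVisits C t m ++ [(0, B)]).map Prod.fst).sum = t := by
      simp [sum_dyadicVisits]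
    rw [hsum, zero_add] at h1
    have hL : cylinder Z.X (fun t ω => Z.X t ω ∈ inner S) (dyadicVisits C t m) 0 ∩
        cylinder Z.X (fun t ω => Z.X t ω ∈ inner S) [(0, B)] t =
        Z.X t ⁻¹' B ∩ Z.dyadicStays C 0 t m := by
      ext ω
      simp only [mem_inter_iff, mem_cylinder_dyadicVisits, cylinder, add_zero, inter_univ,
        mem_ofPred_eq, mem_preimage, dyadicStays]
      constructor
      · exact fun hω => ⟨hω.2.2, fun j hj => (hω.1 j hj).2⟩
      · refine fun hω => ⟨fun j hj => ⟨hCi (hω.2 j hj), hω.2 j hj⟩, ?_, hω.1⟩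
        have := hω.2 (2 ^ m) le_rfl
        have ht : ((2 ^ m : ℕ) : ℝ≥0) * (t / 2 ^ m) = t := by push_cast; field_simp
        rw [ht, zero_add] at this
        exact hCi this
    have hR : cylinder (fun t ω => I (Z.X (Z.clock v t ω).toNNReal ω))
        (fun t ω => Z.clock v t ω < Z.lifetime ω) (dyadicVisits C t m) 0 ∩
        cylinder (fun t ω => I (Z.X (Z.clock v t ω).toNNReal ω))
        (fun t ω => Z.clock v t ω < Z.lifetime ω) [(0, B)] t =
        (fun ω => I (Z.X (Z.aliveClock v t ω).toNNReal ω)) ⁻¹' B ∩ Z.changedStays I v C t m := by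
      ext ω
      rw [inter_comm]
      refine and_congr_left fun hω => ?_
      have hal := clock_lt_of_mem_changedStays hω
      simp only [cylinder, add_zero, inter_univ, mem_ofPred_eq, mem_preimage, aliveClock_eq hal,
        hal, true_and]
    rw [hL, hR] at h1
    rw [Measure.map_apply (Z.measurable_X t) hB, withDensity_apply _ (Z.measurable_X t hB),
      Measure.restrict_restrict (Z.measurable_X t hB), Measure.smul_apply,
      Measure.map_apply hYm hB, Measure.restrict_apply (hYm hB), smul_eq_mul]
    exact h1
  have h3 := congrArg (fun μ => ∫⁻ z, f z ∂μ) key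
  simp only [lintegral_smul_measure, smul_eq_mul] at h3
  rw [lintegral_map hf (Z.measurable_X t), lintegral_map hf hYm,
    lintegral_withDensity_eq_lintegral_mul _ hhm
      (show Measurable fun ω => f (Z.X t ω) from hf.comp (Z.measurable_X t))] at h3
  exact h3

/-- This is the core estimate: inversion carries confinement in C to confinement of X in I(C) up to
γ_t, where optional stopping applies to H. The set C' supplies the margin that the latter requires.
-/
theorem HasIP.setLIntegral_stays_le [LocallyCompactSpace S] (hIP : Z.HasIP I h v)
    (hI : ContinuousOn I (inner S)) {D : Set (State S)} (hD : IsOpen D) {H : State S → ℝ≥0∞}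
    (hHc : ContinuousOn H (D ∩ inner S)) (hH : Z.ExcessiveOn D H) {C C' : Set (State S)}
    (hC : IsCompact C) (hC' : IsCompact C') (hCC' : C ⊆ interior C') (hC'i : C' ⊆ inner S)
    (hC'D : MapsTo I C' D) {x : State S} (hx : x ∈ inner S) (t : ℝ≥0) :
    ∫⁻ ω in Z.stays C t, h (Z.X t ω) * H (I (Z.X t ω)) ∂Z.P x ≤ h x * H (I x) := by
  have hCC : C ⊆ C' := hCC'.trans interior_subset
  have hJ : IsClosed (I '' C) := (hC.image_of_continuousOn (hI.mono (hCC.trans hC'i))).isClosed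
  have hJ' : IsClosed (I '' C') := (hC'.image_of_continuousOn (hI.mono hC'i)).isClosed
  -- I restricts to a continuous involution of E°, hence a homeomorphism, so images of open sets are
  -- preimages.
  have hJJ' : I '' C ⊆ interior (I '' C') := by
    rintro _ ⟨z, hz, rfl⟩
    refine mem_interior.2 ⟨inner S ∩ I ⁻¹' interior C', ?_,
      hI.isOpen_inter_preimage isOpen_inner isOpen_interior,
      hIP.map_mem_inner (hC'i (hCC hz)), ?_⟩
    · exact fun w hw => ⟨I w, interior_subset hw.2, hIP.involutive w⟩
    · rw [mem_preimage, hIP.involutive z]; exact hCC' hz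
  have hJ'D : I '' C' ⊆ D ∩ inner S := by
    rintro _ ⟨z, hz, rfl⟩
    exact ⟨hC'D hz, hIP.map_mem_inner (hC'i hz)⟩
  have hHJ := hH.setLIntegral_stopped_le hD hJ' hJJ' (hJ'D.trans inter_subset_left)
    (hHc.mono (interior_subset.trans hJ'D))
    (fun s => measurableSet_aliveClock_lt (Z := Z) hIP.v_continuous t s) (I x)
  have hsup : ∀ a : ℝ≥0∞, a = ⨆ N : ℕ, min a N := fun a => by
    rw [← inf_iSup_eq]; simp [ENNReal.iSup_natCast]
  have hfm : ∀ N : ℕ, Measurable fun z => min (H (I z)) N := fun N =>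
    (hH.measurable.comp hIP.measurable).min measurable_const
  have key : ∀ N : ℕ, ∫⁻ ω in Z.stays C t, h (Z.X t ω) * min (H (I (Z.X t ω))) N ∂Z.P x ≤
      h x * H (I x) := by
    intro N
    have h1 : ∀ m, ∫⁻ ω in Z.stays C t, h (Z.X t ω) * min (H (I (Z.X t ω))) N ∂Z.P x ≤
        h x * ∫⁻ ω in Z.changedStays I v C t m,
          min (H (I (I (Z.X (Z.aliveClock v t ω).toNNReal ω)))) N ∂Z.P (I x) := by
      intro m
      rw [← hIP.setLIntegral_dyadicStays hx hC.measurableSet (hCC.trans hC'i) t m (hfm N)]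
      refine lintegral_mono_set fun ω hω j hj => hω _ ?_
      rw [zero_add]
      exact dyadic_le hj
    have hhx := hIP.inner_subset hx
    have hfin : ∫⁻ ω, min (H (I (I (Z.X (Z.aliveClock v t ω).toNNReal ω)))) N ∂Z.P (I x) ≠ ∞ := by
      refine ne_top_of_le_ne_top (ENNReal.natCast_ne_top N)
        ((lintegral_mono fun ω => min_le_right _ _).trans ?_)
      simp
    refine (le_iInf h1).trans ?_
    rw [← ENNReal.mul_iInf_of_ne hhx.1.ne' hhx.2.ne,
      iInf_setLIntegral_of_antitone antitone_changedStays (fun m =>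
        measurableSet_changedStays hIP.v_continuous hIP.measurable hC.measurableSet) hfin]
    gcongr
    refine le_trans ?_ hHJ
    refine (lintegral_mono fun ω => min_le_left _ _).trans ?_
    simp only [hIP.involutive _]
    refine lintegral_mono_set fun ω hω => ?_
    have hω' := mem_iInter.1 hω
    have hal := clock_lt_of_mem_changedStays (hω' 0)
    refine ⟨aliveClock_lt_top_iff.2 hal, fun s hs => ?_⟩
    rw [aliveClock_eq hal] at hs
    refine mem_of_le_clock hIP.v_pos hIP.v_continuous hal hJ (fun m j hj => ?_) hs
    exact ⟨_, (mem_changedStays.1 (hω' m) j hj).2, hIP.involutive _⟩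
  calc ∫⁻ ω in Z.stays C t, h (Z.X t ω) * H (I (Z.X t ω)) ∂Z.P x
      = ∫⁻ ω in Z.stays C t, ⨆ N : ℕ, h (Z.X t ω) * min (H (I (Z.X t ω))) N ∂Z.P x := by
        simp_rw [← ENNReal.mul_iSup, ← hsup]
    _ = ⨆ N : ℕ, ∫⁻ ω in Z.stays C t, h (Z.X t ω) * min (H (I (Z.X t ω))) N ∂Z.P x :=
        lintegral_iSup (fun N => (hIP.excessive.measurable.mul (hfm N)).comp (Z.measurable_X _))
          fun N N' h ω => by dsimp only; gcongr
    _ ≤ _ := iSup_le key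

end HasIP

/-! ### From compact sets to I(D), and the limit at time 0. -/

theorem killed_eq_zero_of_notMem_inner {D : Set (State S)} {f : State S → ℝ≥0∞} {x : State S}
    (hx : x ∉ inner S) (hf : f x = 0) (t : ℝ≥0) : Z.killed D t f x = 0 := by
  have : Z.killed D t f x ≤ 0 := by
    refine (setLIntegral_le_lintegral _ _).trans (le_of_eq ?_)
    calc ∫⁻ ω, f (Z.X t ω) ∂Z.P x = ∫⁻ _, 0 ∂Z.P x := by
          refine lintegral_congr_ae ?_
          filter_upwards [Z.start x] with ω hω
          rw [Z.absorbed ω 0 t zero_le (hω ▸ hx), hω, hf]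
      _ = 0 := lintegral_zero
  exact le_antisymm this zero_le

/-- An upper bound for the process killed when it leaves `D`, from upper bounds for the process
killed when it leaves compact subsets. -/
theorem killed_le_of_exhaustion {D : Set (State S)} {f : State S → ℝ≥0∞} (hf : Measurable f)
    (hf0 : ∀ z ∉ inner S, f z = 0) {C : ℕ → Set (State S)} (hC : ∀ k, IsClosed (C k))
    (hCi : ∀ k, C k ⊆ interior (C (k + 1))) (hCU : ⋃ k, C k = D ∩ inner S) {x : State S}
    (hx : x ∈ D ∩ inner S) {t : ℝ≥0} {c : ℝ≥0∞}
    (hle : ∀ k, ∫⁻ ω in Z.stays (C k) t, f (Z.X t ω) ∂Z.P x ≤ c) :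
    Z.killed D t f x ≤ c := by
  have hmono : Monotone C := monotone_nat_of_le_succ fun k => (hCi k).trans interior_subset
  have hm : ∀ k, Measurable ((Z.stays (C k) t).indicator fun ω => f (Z.X t ω)) := fun k =>
    (hf.comp (Z.measurable_X t)).indicator (Z.ℱ.le _ _ (Z.measurableSet_stays (hC k) t))
  calc Z.killed D t f x
      ≤ ∫⁻ ω in {ω | (t : ℝ≥0∞) < exitTime Z.X D ω},
          ⨆ k, (Z.stays (C k) t).indicator (fun ω => f (Z.X t ω)) ω ∂Z.P x := by
        -- The event of not having left D need not be measurable; measurability of the dominating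
        -- supremum is enough.
        refine setLIntegral_mono_ae (Measurable.iSup hm).aemeasurable ?_
        filter_upwards [ae_exists_stays inter_subset_right hC hCi hCU hx t] with ω hω ht
        by_cases hi : Z.X t ω ∈ inner S
        · obtain ⟨k, hk⟩ := hω (lt_exitTime_inter ht (lt_exitTime_inner_iff.2 hi))
          refine le_trans (le_of_eq ?_) (le_iSup _ k)
          rw [indicator_of_mem hk]
        · rw [hf0 _ hi]
          exact zero_le
    _ ≤ ∫⁻ ω, ⨆ k, (Z.stays (C k) t).indicator (fun ω => f (Z.X t ω)) ω ∂Z.P x :=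
        setLIntegral_le_lintegral _ _
    _ = ⨆ k, ∫⁻ ω, (Z.stays (C k) t).indicator (fun ω => f (Z.X t ω)) ω ∂Z.P x := by
        refine lintegral_iSup hm fun k k' h ω => ?_
        exact indicator_le_indicator_of_subset (stays_mono (hmono h) t) (fun _ => zero_le) ω
    _ ≤ c := by
        refine iSup_le fun k => ?_
        rw [lintegral_indicator (Z.ℱ.le _ _ (Z.measurableSet_stays (hC k) t))]
        exact hle k

/-- Right-continuity in time at `0` of the killed semigroup, for a function that is continuous and
superharmonic at the starting point. -/
theorem tendsto_killed [LocallyCompactSpace S] {D : Set (State S)} {f : State S → ℝ≥0∞}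
    {x : State S} (hf : Measurable f) (hfx : ContinuousAt f x) (hD : D ∈ 𝓝 x)
    (hle : ∀ t, Z.killed D t f x ≤ f x) :
    Tendsto (fun t => Z.killed D t f x) (𝓝[>] 0) (𝓝 (f x)) := by
  obtain ⟨C, hCx, hC, hCD⟩ := exists_mem_nhds_isClosed_subset (interior_mem_nhds.2 hD)
  refine tendsto_of_seq_tendsto fun u hu => ?_
  have hu0 : Tendsto u atTop (𝓝[≥] 0) := hu.mono_right (nhdsWithin_mono _ Ioi_subset_Ici_self)
  have hst : ∀ k, MeasurableSet (Z.stays C (u k)) := fun k =>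
    Z.ℱ.le _ _ (Z.measurableSet_stays hC (u k))
  set F : ℕ → Ω → ℝ≥0∞ := fun k => (Z.stays C (u k)).indicator fun ω => f (Z.X (u k) ω) with hF
  have hFm : ∀ k, Measurable (F k) := fun k => (hf.comp (Z.measurable_X _)).indicator (hst k)
  have hFle : ∀ k, ∫⁻ ω, F k ω ∂Z.P x ≤ Z.killed D (u k) f x := fun k => by
    rw [hF, lintegral_indicator (hst k)]
    exact lintegral_mono_set ((stays_subset_lt_exitTime isOpen_interior hCD _).trans
      fun ω hω => lt_of_lt_of_le hω (exitTime_mono interior_subset))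
  -- By right-continuity at 0, almost every path stays in the closed neighbourhood C up to time u k
  -- once k is large, so the indicator is eventually 1.
  have hlim : ∀ᵐ ω ∂Z.P x, f x ≤ liminf (fun k => F k ω) atTop := by
    filter_upwards [Z.start x] with ω hω
    have hX : Tendsto (fun k => Z.X (u k) ω) atTop (𝓝 x) := by
      have := (Z.right_continuous ω 0).tendsto.comp hu0
      rwa [hω] at this
    have hfX : Tendsto (fun k => f (Z.X (u k) ω)) atTop (𝓝 (f x)) := hfx.tendsto.comp hX
    rw [← hfX.liminf_eq]
    refine liminf_le_liminf ?_
    obtain ⟨w, hw, hw'⟩ := (mem_nhdsGE_iff_exists_Ico_subset' (zero_lt_one (α := ℝ≥0))).1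
      ((Z.right_continuous ω 0).eventually (show ∀ᶠ z in 𝓝 (Z.X 0 ω), z ∈ C from hω ▸ hCx))
    filter_upwards [(tendsto_nhds_of_tendsto_nhdsWithin hu0).eventually (gt_mem_nhds hw)]
      with k hk
    have : ω ∈ Z.stays C (u k) := fun s hs => hw' ⟨zero_le, hs.trans_lt hk⟩
    exact (indicator_of_mem this (fun ω => f (Z.X (u k) ω))).ge
  refine tendsto_of_le_liminf_of_limsup_le ?_ ?_
  · calc f x = ∫⁻ _, f x ∂Z.P x := by simp
      _ ≤ ∫⁻ ω, liminf (fun k => F k ω) atTop ∂Z.P x := lintegral_mono_ae hlim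
      _ ≤ liminf (fun k => ∫⁻ ω, F k ω ∂Z.P x) atTop := lintegral_liminf_le hFm
      _ ≤ liminf (fun k => Z.killed D (u k) f x) atTop :=
        liminf_le_liminf (Eventually.of_forall hFle)
  · refine (limsup_le_limsup (Eventually.of_forall fun k => hle (u k))).trans ?_
    simp

/-- If `X` has the inversion property with continuous characteristics `(I, h, v)`, then
`x ↦ h x * H (I x)` is excessive on `I '' D` for every `H` which is excessive on `D`, continuous in
the interior and vanishes on the boundary. -/
theorem HasIP.excessiveOn_image [LocallyCompactSpace S] {I : State S → State S}
    {h : State S → ℝ≥0∞} {v : State S → ℝ} (hIP : Z.HasIP I h v) (hI : ContinuousOn I (inner S))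
    (hh : ContinuousOn h (inner S)) {D : Set (State S)} (hD : IsOpen D) {H : State S → ℝ≥0∞}
    (hH_zero : ∀ x ∉ inner S, H x = 0) (hH_cont : ContinuousOn H (D ∩ inner S))
    (hH : Z.ExcessiveOn D H) : Z.ExcessiveOn (I '' D) fun x => h x * H (I x) := by
  have := secondCountableTopology_state (S := S)
  have hinv := hIP.involutive
  have hW : IsOpen (I '' D ∩ inner S) := by
    rw [hinv.image_eq_preimage_symm, inter_comm]
    exact hI.isOpen_inter_preimage isOpen_inner hD
  have hK : Measurable fun x => h x * H (I x) :=
    hIP.excessive.measurable.mul (hH.measurable.comp hIP.measurable)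
  have hK0 : ∀ x ∉ inner S, h x * H (I x) = 0 := fun x hx => by
    rw [hH_zero, mul_zero]
    exact fun hIx => hx (hinv x ▸ hIP.map_mem_inner hIx)
  have hle : ∀ x ∈ I '' D, ∀ t : ℝ≥0,
      Z.killed (I '' D) t (fun x => h x * H (I x)) x ≤ h x * H (I x) := by
    intro x hxD t
    by_cases hx : x ∈ inner S
    · obtain ⟨C, hC, hCi, hCU⟩ := hW.exists_compact_exhaustion
      have hCW : ∀ k, C k ⊆ I '' D ∩ inner S := fun k => hCU ▸ subset_iUnion C k
      refine killed_le_of_exhaustion hK hK0 (fun k => (hC k).isClosed) hCi hCU ⟨hxD, hx⟩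
        fun k => ?_
      refine hIP.setLIntegral_stays_le hI hD hH_cont hH (hC k) (hC (k + 1)) (hCi k)
        ((hCW _).trans inter_subset_right) (fun z hz => ?_) hx t
      obtain ⟨d, hd, rfl⟩ := (hCW _ hz).1
      rwa [hinv d]
    · rw [killed_eq_zero_of_notMem_inner hx (hK0 x hx)]
      exact zero_le
  refine ⟨hK, hle, fun x hxD => ?_⟩
  by_cases hx : x ∈ inner S
  · refine tendsto_killed hK ?_ (mem_of_superset (hW.mem_nhds ⟨hxD, hx⟩) inter_subset_left)
      (hle x hxD)
    have hIx : I x ∈ D ∩ inner S := by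
      obtain ⟨d, hd, rfl⟩ := hxD
      exact ⟨(hinv d).symm ▸ hd, hIP.map_mem_inner hx⟩
    have hhx := hIP.inner_subset hx
    have hHI : ContinuousAt (fun x => H (I x)) x :=
      ContinuousAt.comp (g := H) (hH_cont.continuousAt ((hD.inter isOpen_inner).mem_nhds hIx))
        (hI.continuousAt (isOpen_inner.mem_nhds hx))
    -- As h(x) is neither 0 nor ∞, the product is continuous even where H ∘ I takes the value 0 or
    -- ∞.
    exact ENNReal.Tendsto.mul (hh.continuousAt (isOpen_inner.mem_nhds hx)) (Or.inl hhx.1.ne')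
      hHI (Or.inr hhx.2.ne)
  · simp only [hK0 x hx]
    exact tendsto_const_nhds.congr fun t => (killed_eq_zero_of_notMem_inner
      (f := fun x => h x * H (I x)) hx (hK0 x hx) t).symm

end StandardProcess

end Inversion

end

theorem theorem2p2 {n : ℕ} (S : Set (EuclideanSpace ℝ (Fin n)))
    (hS_unbounded : ¬ Bornology.IsBounded S) (hS_compact : LocallyCompactSpace S)
    (hS_zero : (0 : EuclideanSpace ℝ (Fin n)) ∈ S)
    {Ω : Type*} [MeasurableSpace Ω] (Z : Inversion.StandardProcess S Ω)
    (I : Inversion.State S → Inversion.State S) (h : Inversion.State S → ℝ≥0∞)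
    (v : Inversion.State S → ℝ) (hIP : Z.HasIP I h v)
    (hI : ContinuousOn I (Inversion.inner S)) (hh : ContinuousOn h (Inversion.inner S))
    (D : Set (Inversion.State S)) (hD : IsOpen D) (hDh : D ⊆ Inversion.finPos h)
    (H : Inversion.State S → ℝ≥0∞) (hH_zero : ∀ x ∉ Inversion.inner S, H x = 0)
    (hH_cont : ContinuousOn H (D ∩ Inversion.inner S)) (hH : Z.ExcessiveOn D H) :
    Z.ExcessiveOn (I '' D) (fun x => h x * H (I x)) :=
  hIP.excessiveOn_image hI hh hD hH_zero hH_cont hH
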